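/- Let $d,r\ge 1$ be integers, $1<p,q<\infty$, $K_1,K_2>0$, and $C_K=[-K_1,K_1]\times[-K_2,K_2]^d\subset\mathbb{R}\times\mathbb{R}^d$. For a measurable $f:\mathbb{R}\times\mathbb{R}^d\to\mathbb{C}$ let $\|f\|_{L^{p,q}}=\big(\int_{\mathbb{R}}(\int_{\mathbb{R}^d}|f(x,y)|^q\,dy)^{p/q}dx\big)^{1/p}$, and let $\|f\|_{L^{p,q}(C_K)}$ be the same expression with the integrals over $[-K_1,K_1]$ and $[-K_2,K_2]^d$ (also for $p=q=1$). For arrays let $\|c\|_{l^{p,q}}=\big(\sum_{k_1}(\sum_{k_2}|c(k_1,k_2)|^q)^{p/q}\big)^{1/p}$, and for $\mathbf{c}=(c_1,\dots,c_r)$ let $\|\mathbf{c}\|_{l^{p,q}}=\sum_{i=1}^r\|c_i\|_{l^{p,q}}$. On $\mathbb{R}^d$, $|\cdot|$ is the Euclidean norm; for $k\in\mathbb{Z}^d$, $|k|=\max_i|k_i|$. Assume: (A1) $\phi_1,\dots,\phi_r:\mathbb{R}\times\mathbb{R}^d\to\mathbb{C}$ are continuous, there are constants $\alpha_1,\alpha_2>0$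 such that for every $\mathbf{c}$ on $\mathbb{Z}\times\mathbb{Z}^d$ with $\|\mathbf{c}\|_{l^{p,q}}<\infty$ $$\alpha_1\|\mathbf{c}\|_{l^{p,q}}\le\Big\|\sum_{k_1\in\mathbb{Z}}\sum_{k_2\in\mathbb{Z}^d}\sum_{i=1}^r c_i(k_1,k_2)\,\phi_i(\cdot-k_1,\cdot-k_2)\Big\|_{L^{p,q}}\le\alpha_2\|\mathbf{c}\|_{l^{p,q}},$$ and there are $\tilde c>0$ and $s_1,s_2>0$ with $s_1,s_2>d+1-\frac1p-\frac dq$ and $|\phi_i(x,y)|\le\tilde c\,(1+|x|)^{-s_1}(1+|y|)^{-s_2}$ for all $i,x,y$. (A2) $\psi\in L^1(\mathbb{R}^{d+1})$ is complex-valued with $\operatorname{supp}\psi\subseteq C_K$. (A3) $\rho$ is a probability density on $C_K$ with $C_{\rho,1}\le\rho\le C_{\rho,2}$ on $C_K$ for constants $C_{\rho,1},C_{\rho,2}>0$. Let $(x_j,y_k)$, $(j,k)\in\mathbb{N}\times\mathbb{N}$, denote a family of independent random points of $C_K$, indexed by the pairs $(j,k)$ (one point for each pair), each with density $\rho$. For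 an integer $N\ge1$ let $V_N^{p,q}(\Phi)$ be the set of all functions $\sum_{i=1}^r\sum_{|k_1|\le N}\sum_{|k_2|\le N}c_i(k_1,k_2)\,\phi_i(\cdot-k_1,\cdot-k_2)$ with complex coefficients, and for $\omega>0$ let $$V_{N,\omega,\psi}^{p,q}(\Phi)=\big\{f\in V_N^{p,q}(\Phi):\ \|f*\psi\|_{L^{p,q}(C_K)}\ge\omega\,\|f\|_{L^{p,q}}\big\}.$$ Put $\|\psi\|=\|\psi\|_{L^{1,1}(C_K)}$, $D=(2K_1)^{q-1}(2K_2)^{d(p-1)}$, $$c^*=\frac{4\tilde c}{2^{\frac{p+q}{pq}}\alpha_1}\Big(\sum_{k_1\in\mathbb{Z}}(1+|k_1|)^{-\frac{s_1p}{p-1}}\Big)^{\frac{p-1}{p}}\Big(\sum_{k_2\in\mathbb{Z}^d}(1+|k_2|)^{-\frac{s_2q}{q-1}}\Big)^{\frac{q-1}{q}}.$$ Let $\gamma\in(0,1)$, $0<\omega\le\|\psi\|$, and put $$L=\frac{C_{\rho,1}(c^*\|\psi\|)^{1-pq}\omega^{pq}}{D},\qquad \tau=\gamma\,C_{\rho,1}\Big(\frac{\omega}{c^*\|\psi\|}\Big)^{pq}.$$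 If $n,m\in\mathbb{N}$ satisfy $$nm>\frac{54\,r\sqrt2\,(\ln2)(2N+1)^{d+1}\|\psi\|}{(\gamma L)^2}\,\big(2\gamma L+81\|\psi\|\big),$$ then, with probability at least $1-\mathcal{A}_1e^{-nm\beta_1}-\mathcal{A}_2e^{-nm\beta_2}$, every $f\in V_{N,\omega,\psi}^{p,q}(\Phi)$ satisfies $$\mathcal{A}_{\gamma,\omega}\|f\|_{L^{p,q}}\le\Big\|\{(f*\psi)(x_j,y_k)\}_{1\le j\le n,\,1\le k\le m}\Big\|_{l^{p,q}}\le\mathcal{B}_{\gamma,\omega}\|f\|_{L^{p,q}},$$ where $$\mathcal{A}_{\gamma,\omega}=(1-\gamma)L\,n^{1/p}m^{1/q},\qquad \mathcal{B}_{\gamma,\omega}=\frac{C_{\rho,2}\|\psi\|}{(2K_1)^{\frac{1-p}{p}}(2K_2)^{d\frac{1-q}{q}}}\,nm+\gamma L\,nm,$$ $$\mathcal{A}_1=2\exp\big(r(2N+1)^{d+1}\ln(4c^*+1)\big),\qquad \mathcal{A}_2=\frac{4\big((2c^*+\frac14)(c^*+\frac14)\big)^{r(2N+1)^{d+1}}}{3r(\ln2)^2(2N+1)^{d+1}},$$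 $$\beta_1=\frac{D^{-1}\big(\frac{\sqrt3}{2}\tau\big)^2}{6D+\tau},\qquad \beta_2=\frac{D^{-1}(\tau c^*)^2}{18\sqrt2\,(81D+2\tau c^*)}.$$ -/

import Mathlib

open MeasureTheory ProbabilityTheory
open scoped ENNReal

noncomputable section

namespace MixedSampling

/-- `ℝ × ℝ^d`, with the Euclidean norm on `ℝ^d`; its `volume` is the product Lebesgue measure. -/
abbrev Pt (d : ℕ) : Type := ℝ × EuclideanSpace ℝ (Fin d)

/-- The cube `[-a, a]^d`. -/
def cube (d : ℕ) (a : ℝ) : Set (EuclideanSpace ℝ (Fin d)) := {y | ∀ i, |y i| ≤ a}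

/-- The cuboid `C_K = [-K₁, K₁] × [-K₂, K₂]^d`. -/
def cuboid (d : ℕ) (K₁ K₂ : ℝ) : Set (Pt d) := Set.Icc (-K₁) K₁ ×ˢ cube d K₂

/-- A multi-index in `ℤ^d` seen as a point of `ℝ^d`. -/
def latt {d : ℕ} (k : Fin d → ℤ) : EuclideanSpace ℝ (Fin d) :=
  WithLp.toLp 2 (fun i => (k i : ℝ))

/-- The mixed norm `(∫_S (∫_T |f(x,y)|^q dy)^{p/q} dx)^{1/p}`, with values in `[0, ∞]`. -/
def mixedNormOn {d : ℕ} (p q : ℝ) (S : Set ℝ) (T : Set (EuclideanSpace ℝ (Fin d)))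
    (f : Pt d → ℂ) : ℝ≥0∞ :=
  (∫⁻ x in S, (∫⁻ y in T, ‖f (x, y)‖ₑ ^ q) ^ (p / q)) ^ (1 / p)

/-- The norm of `L^{p,q}(ℝ × ℝ^d)`. -/
def mixedNorm {d : ℕ} (p q : ℝ) (f : Pt d → ℂ) : ℝ≥0∞ :=
  mixedNormOn p q Set.univ Set.univ f

/-- The norm of `L^{p,q}(C_K)`. -/
def mixedNormCuboid {d : ℕ} (p q K₁ K₂ : ℝ) (f : Pt d → ℂ) : ℝ≥0∞ :=
  mixedNormOn p q (Set.Icc (-K₁) K₁) (cube d K₂) f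

/-- The norm of `l^{p,q}(ℤ × ℤ^d)`. -/
def seqNorm {d : ℕ} (p q : ℝ) (c : ℤ → (Fin d → ℤ) → ℂ) : ℝ≥0∞ :=
  (∑' k₁ : ℤ, (∑' k₂ : Fin d → ℤ, ‖c k₁ k₂‖ₑ ^ q) ^ (p / q)) ^ (1 / p)

/-- The norm of `(l^{p,q})^r`: the sum of the norms of the `r` components. -/
def vecSeqNorm {d r : ℕ} (p q : ℝ) (c : Fin r → ℤ → (Fin d → ℤ) → ℂ) : ℝ≥0∞ :=
  ∑ i, seqNorm p q (c i)

/-- The `l^{p,q}` norm of the finite array `a j k`, `1 ≤ j ≤ n`, `1 ≤ k ≤ m`. -/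
def sampleNorm (p q : ℝ) (n m : ℕ) (a : ℕ → ℕ → ℂ) : ℝ≥0∞ :=
  (∑ j ∈ Finset.Icc 1 n, (∑ k ∈ Finset.Icc 1 m, ‖a j k‖ₑ ^ q) ^ (p / q)) ^ (1 / p)

/-- The function `∑_{k₁} ∑_{k₂} c(k₁,k₂)ᵀ Φ(· - k₁, · - k₂)`. -/
def synth {d r : ℕ} (φ : Fin r → Pt d → ℂ) (c : Fin r → ℤ → (Fin d → ℤ) → ℂ) : Pt d → ℂ :=
  fun z => ∑' k₁ : ℤ, ∑' k₂ : Fin d → ℤ, ∑ i, c i k₁ k₂ * φ i (z.1 - (k₁ : ℝ), z.2 - latt k₂)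

/-- Assumption on the generators: continuity, polynomial decay, and stable shifts.
The decay makes the series in `synth` converge absolutely at every point, for each `c` with
finite norm. -/
structure Generators {d r : ℕ} (p q α₁ α₂ ct s₁ s₂ : ℝ) (φ : Fin r → Pt d → ℂ) : Prop where
  alpha_one_pos : 0 < α₁
  alpha_two_pos : 0 < α₂
  stable : ∀ c : Fin r → ℤ → (Fin d → ℤ) → ℂ, vecSeqNorm p q c < ∞ →
    ENNReal.ofReal α₁ * vecSeqNorm p q c ≤ mixedNorm p q (synth φ c) ∧
      mixedNorm p q (synth φ c) ≤ ENNReal.ofReal α₂ * vecSeqNorm p q c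
  continuous : ∀ i, Continuous (φ i)
  ct_pos : 0 < ct
  s_one_pos : 0 < s₁
  s_two_pos : 0 < s₂
  s_one_gt : (d : ℝ) + 1 - 1 / p - d / q < s₁
  s_two_gt : (d : ℝ) + 1 - 1 / p - d / q < s₂
  decay : ∀ i (x : ℝ) (y : EuclideanSpace ℝ (Fin d)),
    ‖φ i (x, y)‖ ≤ ct / ((1 + |x|) ^ s₁ * (1 + ‖y‖) ^ s₂)

/-- Assumption on the averaging function: `ψ ∈ L¹` with (essential) support in `C_K`. -/
structure Averaging {d : ℕ} (K₁ K₂ : ℝ) (ψ : Pt d → ℂ) : Prop where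
  integrable : Integrable ψ
  support : ∀ᵐ z, z ∉ cuboid d K₁ K₂ → ψ z = 0

/-- Assumption on the density: a probability density on `C_K` with values in `[c₁, c₂]`. -/
structure Density {d : ℕ} (K₁ K₂ c₁ c₂ : ℝ) (ρ : Pt d → ℝ) : Prop where
  c_one_pos : 0 < c₁
  c_two_pos : 0 < c₂
  aemeasurable : AEMeasurable ρ (volume.restrict (cuboid d K₁ K₂))
  bounds : ∀ z ∈ cuboid d K₁ K₂, c₁ ≤ ρ z ∧ ρ z ≤ c₂
  mass : ∫⁻ z in cuboid d K₁ K₂, ENNReal.ofReal (ρ z) = 1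

/-- The probability distribution on `C_K` with density `ρ`. -/
def law {d : ℕ} (K₁ K₂ : ℝ) (ρ : Pt d → ℝ) : Measure (Pt d) :=
  (volume.restrict (cuboid d K₁ K₂)).withDensity (fun z => ENNReal.ofReal (ρ z))

/-- The convolution `(f * ψ)(z) = ∫ f(t) ψ(z - t) dt`. -/
def conv {d : ℕ} (f ψ : Pt d → ℂ) : Pt d → ℂ :=
  convolution f ψ (ContinuousLinearMap.mul ℂ ℂ) volume

/-- The space `V_N^{p,q}(Φ)`: finite combinations of the shifts with `|k₁| ≤ N`, `|k₂|_∞ ≤ N`. -/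
def VN {d r : ℕ} (N : ℕ) (φ : Fin r → Pt d → ℂ) : Set (Pt d → ℂ) :=
  {f | ∃ c : Fin r → ℤ → (Fin d → ℤ) → ℂ, f = fun z =>
    ∑ i, ∑ k₁ ∈ Finset.Icc (-(N : ℤ)) N,
      ∑ k₂ ∈ Fintype.piFinset (fun _ : Fin d => Finset.Icc (-(N : ℤ)) N),
        c i k₁ k₂ * φ i (z.1 - (k₁ : ℝ), z.2 - latt k₂)}

/-- The class `V_{N,ω,ψ}^{p,q}(Φ)` of the `f ∈ V_N^{p,q}(Φ)` with
`‖f * ψ‖_{L^{p,q}(C_K)} ≥ ω ‖f‖_{L^{p,q}(ℝ × ℝ^d)}`. -/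
def VNomega {d r : ℕ} (p q K₁ K₂ : ℝ) (N : ℕ) (ω : ℝ) (ψ : Pt d → ℂ)
    (φ : Fin r → Pt d → ℂ) : Set (Pt d → ℂ) :=
  {f | f ∈ VN N φ ∧
    ENNReal.ofReal ω * mixedNorm p q f ≤ mixedNormCuboid p q K₁ K₂ (conv f ψ)}

/-- The real number `‖ψ‖_{L^{1,1}(C_K)}`. -/
def avgNorm {d : ℕ} (K₁ K₂ : ℝ) (ψ : Pt d → ℂ) : ℝ := (mixedNormCuboid 1 1 K₁ K₂ ψ).toReal

/-- The constant `c*`. For `k₂ : Fin d → ℤ`, `‖k₂‖` is the maximum norm. -/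
def cStar (d : ℕ) (p q α₁ ct s₁ s₂ : ℝ) : ℝ :=
  4 * ct / (2 ^ ((p + q) / (p * q)) * α₁)
    * (∑' k₁ : ℤ, 1 / (1 + |(k₁ : ℝ)|) ^ (s₁ * p / (p - 1))) ^ ((p - 1) / p)
    * (∑' k₂ : Fin d → ℤ, 1 / (1 + ‖k₂‖) ^ (s₂ * q / (q - 1))) ^ ((q - 1) / q)

/-- `(2K₁)^{q-1} (2K₂)^{d(p-1)}`. -/
def boxFactor (d : ℕ) (p q K₁ K₂ : ℝ) : ℝ :=
  (2 * K₁) ^ (q - 1) * (2 * K₂) ^ ((d : ℝ) * (p - 1))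

/-- `C_{ρ,1} (c* ‖ψ‖)^{1-pq} ω^{pq} / ((2K₁)^{q-1} (2K₂)^{d(p-1)})`; here `cs` stands for `c*` and
`nψ` for `‖ψ‖_{L^{1,1}(C_K)}`. -/
def level (d : ℕ) (p q K₁ K₂ c₁ cs nψ ω : ℝ) : ℝ :=
  c₁ * (cs * nψ) ^ (1 - p * q) * ω ^ (p * q) / boxFactor d p q K₁ K₂

/-- The lower bound for the number `nm` of samples. -/
def sampleThreshold (d r N : ℕ) (p q K₁ K₂ c₁ cs nψ ω γ : ℝ) : ℝ :=
  54 * r * √2 * Real.log 2 * (2 * N + 1) ^ (d + 1) * nψ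
      / (γ * level d p q K₁ K₂ c₁ cs nψ ω) ^ 2
    * (2 * (γ * level d p q K₁ K₂ c₁ cs nψ ω) + 81 * nψ)

/-- The lower sampling constant `A_{γ,ω}`. -/
def lowerConst (d n m : ℕ) (p q K₁ K₂ c₁ cs nψ ω γ : ℝ) : ℝ :=
  (1 - γ) * level d p q K₁ K₂ c₁ cs nψ ω * (n : ℝ) ^ (1 / p) * (m : ℝ) ^ (1 / q)

/-- The upper sampling constant `B_{γ,ω}`. -/
def upperConst (d n m : ℕ) (p q K₁ K₂ c₁ c₂ cs nψ ω γ : ℝ) : ℝ :=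
  c₂ * nψ / ((2 * K₁) ^ ((1 - p) / p) * (2 * K₂) ^ ((d : ℝ) * ((1 - q) / q))) * (n * m)
    + γ * level d p q K₁ K₂ c₁ cs nψ ω * (n * m)

/-- The constant `𝒜₁`. -/
def probA₁ (d r N : ℕ) (cs : ℝ) : ℝ :=
  2 * Real.exp (r * (2 * N + 1) ^ (d + 1) * Real.log (4 * cs + 1))

/-- The constant `𝒜₂`. -/
def probA₂ (d r N : ℕ) (cs : ℝ) : ℝ :=
  4 * ((2 * cs + 1 / 4) * (cs + 1 / 4)) ^ (r * (2 * N + 1) ^ (d + 1))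
    / (3 * r * (Real.log 2) ^ 2 * (2 * N + 1) ^ (d + 1))

/-- The quantity `γ C_{ρ,1} (ω / (c* ‖ψ‖))^{pq}`. -/
def ratio (p q c₁ cs nψ ω γ : ℝ) : ℝ := γ * c₁ * (ω / (cs * nψ)) ^ (p * q)

/-- The exponent `β₁`. -/
def beta₁ (d : ℕ) (p q K₁ K₂ c₁ cs nψ ω γ : ℝ) : ℝ :=
  (2 * K₁) ^ (1 - q) * (2 * K₂) ^ ((d : ℝ) * (1 - p))
      * (√3 / 2 * ratio p q c₁ cs nψ ω γ) ^ 2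
    / (6 * boxFactor d p q K₁ K₂ + ratio p q c₁ cs nψ ω γ)

/-- The exponent `β₂`. -/
def beta₂ (d : ℕ) (p q K₁ K₂ c₁ cs nψ ω γ : ℝ) : ℝ :=
  (2 * K₁) ^ (1 - q) * (2 * K₂) ^ ((d : ℝ) * (1 - p))
      * (ratio p q c₁ cs nψ ω γ * cs) ^ 2
    / (18 * √2 * (81 * boxFactor d p q K₁ K₂ + 2 * ratio p q c₁ cs nψ ω γ * cs))

end MixedSampling

end

/-! Write M = r(2N+1)^{d+1}, t = γL/(c*‖ψ‖) and A = ‖f‖_{L^{p,q}}. Everything reduces to comparing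
the sample sum of |f*ψ| with nm times its mean under the law ρ, uniformly over V_N.

Three facts carry the proof. (1) Sup bound, `VN_bound`: |f| ≤ c*A on V_N. Two Hölder inequalities
bound f by its coefficients times lattice sums of the decay weights, and the lower stability
estimate replaces coefficients by A. The factor 4/2^{1/p+1/q} in c* exceeds 1 but may be close to 1,
so a translated lattice sum must be bounded by the untranslated one with no loss. For Gaussians this
is Poisson summation; powers (1+R)^{-t} are mixtures of exponentials, and these of Gaussians
(`tsum_rpow_le_of_gaussian`). (2) Mean, `mean_bounds`: with g = f*ψ, ‖g‖_{L^{p,q}(C_K)}^{pq} ≤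
D∫|g|^{pq} ≤ D‖g‖_∞^{pq-1}∫|g|, where |g| ≤ c*A‖ψ‖; hence f in the class V_{N,ω,ψ} has mean at least
LA. Fubini and Hölder give the upper bound. (3) Deviation, `uniform_deviation`: on the sup-norm unit
ball of a space of real dimension at most 2M, chaining with Hoeffding's inequality gives deviation
at most nm·t, outside an event of probability at most 2exp(-nm t²/8), as soon as nm t² ≥ 24M. After
rescaling, the deviation is at most nm·γLA.

Hence the sample sum is at least (1-γ)L·nm·A, and at most the upper mean bound plus γLA, times nm.
Hölder and the inclusion of l^1 in l^{p,q} pass to the array norm.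

For the probability, β₁ ≤ t²/8. The sampling hypothesis only gives nm t² c*² > 4200M; if nm t² <
24M, then c* is so large that 𝒜₁e^{-nmβ₁} ≥ 1 and the claim is void. The 𝒜₂ term is never needed
beyond its sign. -/

open MeasureTheory ProbabilityTheory
open scoped ENNReal

/-! ### Nets, Hoeffding's inequality and chaining -/

namespace MixedSampling

/-- A finite subset of the unit ball of a finite-dimensional real normed space whose points are
`ε`-separated has at most `(1 + 2 / ε) ^ dim` elements. -/
lemma card_le_of_separated_unitBall {E : Type*} [NormedAddCommGroup E] [NormedSpace ℝ E]
    [FiniteDimensional ℝ E] {ε : ℝ} (hε : 0 < ε) (s : Finset E) (hs : ∀ c ∈ s, ‖c‖ ≤ 1)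
    (h : ∀ c ∈ s, ∀ e ∈ s, c ≠ e → ε ≤ ‖c - e‖) :
    (s.card : ℝ) ≤ (1 + 2 / ε) ^ Module.finrank ℝ E := by
  borelize E
  let μ : Measure E := Measure.addHaar
  have hδ : 0 < ε / 2 := by positivity
  have hρ : 0 < 1 + ε / 2 := by positivity
  -- Volume packing: disjoint balls of radius ε/2 all lie in the ball of radius 1 + ε/2.
  have hdisj : Set.Pairwise (s : Set E)
      (Function.onFun Disjoint fun c => Metric.ball (c : E) (ε / 2)) := by
    rintro c hc e he hce
    apply Metric.ball_disjoint_ball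
    rw [dist_eq_norm]
    linarith [h c hc e he hce]
  have hsub : (⋃ c ∈ s, Metric.ball (c : E) (ε / 2)) ⊆ Metric.ball (0 : E) (1 + ε / 2) := by
    refine Set.iUnion₂_subset fun x hx => Metric.ball_subset_ball' ?_
    rw [dist_zero_right]
    linarith [hs x hx]
  have hvol : (s.card : ℝ≥0∞) * ENNReal.ofReal ((ε / 2) ^ Module.finrank ℝ E)
        * μ (Metric.ball 0 1) ≤
      ENNReal.ofReal ((1 + ε / 2) ^ Module.finrank ℝ E) * μ (Metric.ball 0 1) :=
    calc
      _ = μ (⋃ c ∈ s, Metric.ball (c : E) (ε / 2)) := by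
        rw [measure_biUnion_finset hdisj fun c _ => measurableSet_ball]
        simp only [μ.addHaar_ball_of_pos _ hδ]
        simp only [Finset.sum_const, nsmul_eq_mul, mul_assoc]
      _ ≤ μ (Metric.ball (0 : E) (1 + ε / 2)) := measure_mono hsub
      _ = _ := by simp only [μ.addHaar_ball_of_pos _ hρ]
  have hvol' := (ENNReal.mul_le_mul_iff_left (Metric.measure_ball_pos _ _ zero_lt_one).ne'
    measure_ball_lt_top.ne).1 hvol
  have hreal := ENNReal.toReal_le_of_le_ofReal (pow_nonneg hρ.le _) hvol'
  rw [ENNReal.toReal_mul, ENNReal.toReal_natCast, ENNReal.toReal_ofReal (by positivity)] at hreal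
  have : (1 + 2 / ε) = (1 + ε / 2) / (ε / 2) := by field_simp; ring
  rw [this, div_pow, le_div_iff₀ (by positivity)]
  exact hreal

/-- The unit ball of a finite-dimensional real normed space has an `ε`-net with at most
`(1 + 2 / ε) ^ dim` elements. -/
lemma exists_net_unitBall (E : Type*) [NormedAddCommGroup E] [NormedSpace ℝ E]
    [FiniteDimensional ℝ E] {ε : ℝ} (hε : 0 < ε) :
    ∃ T : Finset E, (∀ c ∈ T, ‖c‖ ≤ 1) ∧ (T.card : ℝ) ≤ (1 + 2 / ε) ^ Module.finrank ℝ E ∧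
      ∀ v : E, ‖v‖ ≤ 1 → ∃ c ∈ T, ‖v - c‖ ≤ ε := by
  classical
  let Q : Finset E → Prop := fun s => (∀ c ∈ s, ‖c‖ ≤ 1) ∧
    ∀ c ∈ s, ∀ e ∈ s, c ≠ e → ε ≤ ‖c - e‖
  let B := ⌊(1 + 2 / ε) ^ Module.finrank ℝ E⌋₊
  have hB : ∀ s, Q s → s.card ≤ B := fun s hs =>
    Nat.le_floor (card_le_of_separated_unitBall hε s hs.1 hs.2)
  -- A separated set of maximal cardinality is a net, since a point far from it could be added. The
  -- packing bound makes the maximum exist.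
  obtain ⟨T, hT, hTc⟩ := Nat.findGreatest_spec (P := fun k => ∃ s, Q s ∧ s.card = k)
    (Nat.zero_le B) ⟨∅, ⟨by simp, by simp⟩, by simp⟩
  refine ⟨T, hT.1, card_le_of_separated_unitBall hε T hT.1 hT.2, fun v hv => ?_⟩
  by_contra! hcon
  have hvT : v ∉ T := fun hv' => by
    have := hcon v hv'
    simp at this
    linarith
  have hQ : Q (insert v T) := by
    refine ⟨by simpa using ⟨hv, hT.1⟩, ?_⟩
    intro c hc e he hce
    rcases Finset.mem_insert.1 hc with rfl | hc'
    · rcases Finset.mem_insert.1 he with rfl | he'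
      · exact absurd rfl hce
      · exact (hcon e he').le
    · rcases Finset.mem_insert.1 he with rfl | he'
      · rw [norm_sub_rev]; exact (hcon c hc').le
      · exact hT.2 c hc' e he' hce
  have h1 := Nat.le_findGreatest (P := fun k => ∃ s, Q s ∧ s.card = k) (hB _ hQ) ⟨_, hQ, rfl⟩
  rw [← hTc, Finset.card_insert_of_notMem hvT] at h1
  omega

variable {Ω S ι : Type*} [MeasurableSpace Ω] [MeasurableSpace S]

/-- Hoeffding's inequality for a bounded function of independent identically distributed points. -/
lemma hoeffding_two_sided (P : Measure Ω) [IsProbabilityMeasure P] {Z : ι → Ω → S}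
    (hZ : ∀ a, Measurable (Z a)) (hindep : iIndepFun Z P) {κ : Measure S}
    (hlaw : ∀ a, P.map (Z a) = κ) {h : S → ℝ} (hm : Measurable h) {a b : ℝ}
    (hab : ∀ z, h z ∈ Set.Icc a b) (s : Finset ι) {u : ℝ} (hu : 0 ≤ u) :
    P {w | u < |∑ i ∈ s, h (Z i w) - s.card * ∫ z, h z ∂κ|} ≤
      ENNReal.ofReal (2 * Real.exp (-(2 * u ^ 2 / (s.card * (b - a) ^ 2)))) := by
  have hmean : ∀ i, P[fun w => h (Z i w)] = ∫ z, h z ∂κ := fun i => by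
    rw [← hlaw i, integral_map (hZ i).aemeasurable hm.aestronglyMeasurable]
  have hsub : ∀ i, HasSubgaussianMGF (fun w => h (Z i w) - ∫ z, h z ∂κ)
      ((‖b - a‖₊ / 2) ^ 2) P := fun i => by
    have := hasSubgaussianMGF_of_mem_Icc (μ := P) (X := fun w => h (Z i w))
      (hm.comp (hZ i)).aemeasurable (Filter.Eventually.of_forall fun w => hab (Z i w))
    rwa [hmean i] at this
  have hind : iIndepFun (fun i w => h (Z i w) - ∫ z, h z ∂κ) P :=
    hindep.comp (fun _ z => h z - ∫ z, h z ∂κ) fun _ => hm.sub_const _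
  have hind' : iIndepFun (fun i w => -(h (Z i w) - ∫ z, h z ∂κ)) P :=
    hindep.comp (fun _ z => -(h z - ∫ z, h z ∂κ)) fun _ => (hm.sub_const _).neg
  have h1 := HasSubgaussianMGF.measure_sum_ge_le_of_iIndepFun hind (s := s)
    (fun i _ => hsub i) hu
  have h2 := HasSubgaussianMGF.measure_sum_ge_le_of_iIndepFun hind' (s := s)
    (fun i _ => (hsub i).neg) hu
  have hexp : ∀ c : NNReal, c = (‖b - a‖₊ / 2) ^ 2 →
      -u ^ 2 / (2 * ((∑ i ∈ s, c : NNReal) : ℝ)) = -(2 * u ^ 2 / (s.card * (b - a) ^ 2)) := by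
    rintro c rfl
    have : ((‖b - a‖₊ : NNReal) : ℝ) ^ 2 = (b - a) ^ 2 := by
      rw [coe_nnnorm, Real.norm_eq_abs, sq_abs]
    simp only [Finset.sum_const, nsmul_eq_mul]
    push_cast
    rw [div_pow, ← coe_nnnorm, this, neg_div]
    congr 1
    rw [show (2 : ℝ) * (s.card * ((b - a) ^ 2 / 2 ^ 2)) = (s.card * (b - a) ^ 2) / 2 by ring]
    rw [div_div_eq_mul_div]
    ring
  rw [hexp _ rfl] at h1 h2
  have hcover : {w | u < |∑ i ∈ s, h (Z i w) - s.card * ∫ z, h z ∂κ|} ⊆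
      {w | u ≤ ∑ i ∈ s, (h (Z i w) - ∫ z, h z ∂κ)} ∪
        {w | u ≤ ∑ i ∈ s, -(h (Z i w) - ∫ z, h z ∂κ)} := by
    intro w hw
    have hw' : u < |∑ i ∈ s, h (Z i w) - s.card * ∫ z, h z ∂κ| := hw
    simp only [Set.mem_union, Set.mem_ofPred_eq, Finset.sum_neg_distrib, Finset.sum_sub_distrib,
      Finset.sum_const, nsmul_eq_mul]
    rcases lt_abs.1 hw' with h | h
    · exact Or.inl h.le
    · exact Or.inr h.le
  calc _ ≤ _ := measure_mono hcover
    _ ≤ _ := measure_union_le _ _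
    _ ≤ ENNReal.ofReal (Real.exp (-(2 * u ^ 2 / (s.card * (b - a) ^ 2)))) +
        ENNReal.ofReal (Real.exp (-(2 * u ^ 2 / (s.card * (b - a) ^ 2)))) := by
      gcongr
      · rw [← ofReal_measureReal]; exact ENNReal.ofReal_le_ofReal h1
      · rw [← ofReal_measureReal]; exact ENNReal.ofReal_le_ofReal h2
    _ = _ := by rw [← ENNReal.ofReal_add (by positivity) (by positivity), ← two_mul]

/-- The numerical estimate behind the first level of the chaining argument. -/
lemma chaining_first_level {M : ℕ} (hM : 1 ≤ M) {x : ℝ} (hx : 24 * M ≤ x) :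
    (1 + 2 / (1 / 8 : ℝ)) ^ (2 * M) * (2 * Real.exp (-(x / 2))) ≤
      2 * Real.exp (-(x / 8)) * (1 / 2) ^ 1 := by
  -- This is where 24 comes from: 3x/8 ≥ 9M, and e^{9M} beats the net size 17^{2M} = 289^M with a
  -- factor 2^M to spare.
  have h1 : Real.exp (-(x / 2)) ≤ Real.exp (-(x / 8)) * Real.exp (-(9 * M)) := by
    rw [← Real.exp_add]
    apply Real.exp_le_exp.2
    linarith
  have h2 : (578 : ℝ) ≤ Real.exp 9 := by
    rw [show (9 : ℝ) = (9 : ℕ) * 1 by norm_num, Real.exp_nat_mul]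
    calc (578 : ℝ) ≤ 2.7 ^ 9 := by norm_num
      _ ≤ _ := by gcongr; exact le_trans (by norm_num) Real.exp_one_gt_d9.le
  have h3 : (17 : ℝ) ^ (2 * M) * Real.exp (-(9 * M)) ≤ 1 / 2 := by
    rw [Real.exp_neg, mul_comm (9 : ℝ), Real.exp_nat_mul, ← div_eq_mul_inv, pow_mul, ← div_pow]
    calc (17 ^ 2 / Real.exp 9) ^ M ≤ (1 / 2 : ℝ) ^ M := by
          refine pow_le_pow_left₀ (by positivity) ?_ M
          rw [div_le_div_iff₀ (Real.exp_pos _) (by norm_num)]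
          linarith
      _ ≤ (1 / 2) ^ 1 := pow_le_pow_of_le_one (by norm_num) (by norm_num) hM
      _ = 1 / 2 := by norm_num
  have h4 : (1 + 2 / (1 / 8 : ℝ)) = 17 := by norm_num
  rw [h4]
  calc (17 : ℝ) ^ (2 * M) * (2 * Real.exp (-(x / 2)))
      ≤ 17 ^ (2 * M) * (2 * (Real.exp (-(x / 8)) * Real.exp (-(9 * M)))) := by gcongr
    _ = 2 * Real.exp (-(x / 8)) * (17 ^ (2 * M) * Real.exp (-(9 * M))) := by ring
    _ ≤ _ := by gcongr; simpa using h3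

/-- The numerical estimate behind the later levels of the chaining argument. -/
lemma chaining_later_level {M : ℕ} (hM : 1 ≤ M) {x : ℝ} (hx : 24 * M ≤ x) (k : ℕ) :
    (1 + 2 / ((1 / 8 : ℝ) ^ (k + 2))) ^ (2 * M) * (2 * Real.exp (-(x * 16 ^ (k + 1) / 8))) ≤
      2 * Real.exp (-(x / 8)) * (1 / 2) ^ (k + 2) := by
  have hM' : (1 : ℝ) ≤ M := by exact_mod_cast hM
  -- Bernoulli turns the exponent x·16^{k+1}/8 into x/8 + 45(k+1)M. The net costs at most
  -- e^{18(k+1)M}; the remaining 27(k+1)M pays for the factor 2^{-(k+2)}.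
  have h16 : 1 + 15 * ((k : ℝ) + 1) ≤ 16 ^ (k + 1) := by
    have := one_add_mul_le_pow (a := (15 : ℝ)) (by norm_num) (k + 1)
    push_cast at this
    norm_num at this
    linarith
  have h1 : Real.exp (-(x * 16 ^ (k + 1) / 8)) ≤
      Real.exp (-(x / 8)) * Real.exp (-(45 * (k + 1) * M)) := by
    rw [← Real.exp_add]
    apply Real.exp_le_exp.2
    have hx0 : 0 ≤ x := by linarith
    have : x * (1 + 15 * ((k : ℝ) + 1)) ≤ x * 16 ^ (k + 1) := by gcongr
    have h' : 24 * (M : ℝ) * (15 * (k + 1)) ≤ x * (15 * (k + 1)) := by gcongr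
    linarith
  have h8 : (1 + 2 / ((1 / 8 : ℝ) ^ (k + 2))) ≤ 8 ^ (k + 3) := by
    rw [one_div, inv_pow, div_inv_eq_mul, pow_succ (8 : ℝ) (k + 2)]
    have : (1 : ℝ) ≤ 8 ^ (k + 2) := one_le_pow₀ (by norm_num)
    linarith
  have hexp : (8 : ℝ) ^ (k + 3) ≤ Real.exp (9 * (k + 1)) := by
    have h3 : (8 : ℝ) ≤ Real.exp 3 := by
      rw [show (3 : ℝ) = (3 : ℕ) * 1 by norm_num, Real.exp_nat_mul]
      calc (8 : ℝ) ≤ 2.7 ^ 3 := by norm_num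
        _ ≤ _ := by gcongr; exact le_trans (by norm_num) Real.exp_one_gt_d9.le
    calc (8 : ℝ) ^ (k + 3) ≤ Real.exp 3 ^ (k + 3) := by gcongr
      _ = Real.exp ((k + 3 : ℕ) * 3) := (Real.exp_nat_mul _ _).symm
      _ ≤ _ := by
        apply Real.exp_le_exp.2
        push_cast
        nlinarith [(Nat.cast_nonneg k : (0 : ℝ) ≤ k)]
  have hhalf : Real.exp (-(27 * (k + 1) * M)) ≤ (1 / 2 : ℝ) ^ (k + 2) := by
    have h2 : (2 : ℝ) ≤ Real.exp 1 := le_trans (by norm_num) Real.exp_one_gt_d9.le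
    have : Real.exp (-(27 * (k + 1) * M)) ≤ Real.exp (-((k + 2 : ℕ) * 1)) := by
      apply Real.exp_le_exp.2
      push_cast
      have : (27 : ℝ) * (k + 1) * 1 ≤ 27 * (k + 1) * M := by gcongr
      nlinarith [(Nat.cast_nonneg k : (0 : ℝ) ≤ k)]
    refine this.trans ?_
    rw [Real.exp_neg, Real.exp_nat_mul, one_div, inv_pow]
    gcongr
  calc (1 + 2 / ((1 / 8 : ℝ) ^ (k + 2))) ^ (2 * M) * (2 * Real.exp (-(x * 16 ^ (k + 1) / 8)))
      ≤ (Real.exp (9 * (k + 1))) ^ (2 * M) *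
        (2 * (Real.exp (-(x / 8)) * Real.exp (-(45 * (k + 1) * M)))) := by
        gcongr
        exact h8.trans hexp
    _ = 2 * Real.exp (-(x / 8)) * Real.exp (-(27 * (k + 1) * M)) := by
        rw [← Real.exp_nat_mul]
        have : Real.exp (-(27 * ((k : ℝ) + 1) * M)) = Real.exp ((2 * M : ℕ) * (9 * ((k : ℝ) + 1)))
            * Real.exp (-(45 * (k + 1) * M)) := by
          rw [← Real.exp_add]; congr 1; push_cast; ring
        rw [this]; ring
    _ ≤ _ := by gcongr

/-- Uniform deviation inequality, by chaining over nets of the unit ball of a space of dimension at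
most `2 * M`. -/
theorem uniform_deviation (P : Measure Ω) [IsProbabilityMeasure P] {Z : ι → Ω → S}
    (hZ : ∀ a, Measurable (Z a)) (hindep : iIndepFun Z P) {κ : Measure S}
    (hlaw : ∀ a, P.map (Z a) = κ) (s : Finset ι)
    {E : Type*} [NormedAddCommGroup E] [NormedSpace ℝ E] [FiniteDimensional ℝ E]
    {M : ℕ} (hM : 1 ≤ M) (hdim : Module.finrank ℝ E ≤ 2 * M)
    {F : E → S → ℝ} (hF : ∀ v, Measurable (F v)) (hF0 : ∀ v z, 0 ≤ F v z)
    (hF1 : ∀ v z, F v z ≤ ‖v‖) (hlip : ∀ v w z, |F v z - F w z| ≤ ‖v - w‖)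
    {t : ℝ} (ht : 0 < t) (hx : 24 * M ≤ s.card * t ^ 2) :
    ∃ B : Set Ω, MeasurableSet B ∧
      P B ≤ ENNReal.ofReal (2 * Real.exp (-(s.card * t ^ 2 / 8))) ∧
      ∀ w ∉ B, ∀ v, ‖v‖ ≤ 1 →
        |∑ i ∈ s, F v (Z i w) - s.card * ∫ z, F v z ∂κ| ≤ s.card * t := by
  have hn : (0 : ℝ) < s.card := by
    have hM' : (1 : ℝ) ≤ M := by exact_mod_cast hM
    by_contra hcon
    have : (s.card : ℝ) * t ^ 2 ≤ 0 := mul_nonpos_of_nonpos_of_nonneg (not_lt.1 hcon) (sq_nonneg t)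
    linarith
  obtain ⟨a₀, -⟩ : s.Nonempty := Finset.card_pos.1 (by exact_mod_cast hn)
  have : IsProbabilityMeasure κ :=
    hlaw a₀ ▸ Measure.isProbabilityMeasure_map (hZ a₀).aemeasurable
  have hint : ∀ v, Integrable (F v) κ := fun v =>
    Integrable.of_bound (hF v).aestronglyMeasurable ‖v‖ (Filter.Eventually.of_forall fun z => by
      rw [Real.norm_eq_abs, abs_of_nonneg (hF0 v z)]; exact hF1 v z)
  set n : ℝ := (s.card : ℝ) with hn_def
  let D : E → Ω → ℝ := fun v w => ∑ i ∈ s, F v (Z i w) - n * ∫ z, F v z ∂κ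
  have hDm : ∀ v, Measurable (D v) := fun v =>
    (Finset.measurable_sum _ fun i _ => (hF v).comp (hZ i)).sub_const _
  have hε : ∀ k : ℕ, (0 : ℝ) < (1 / 8) ^ k := fun k => by positivity
  choose T hT1 hTc hTn using fun k : ℕ => exists_net_unitBall E (hε k)
  have hcard : ∀ k, ((T k).card : ℝ) ≤ (1 + 2 / (1 / 8 : ℝ) ^ k) ^ (2 * M) := fun k =>
    (hTc k).trans (pow_le_pow_right₀ (by have := hε k; rw [le_add_iff_nonneg_right]; positivity)
      hdim)
  -- The value outside the unit ball is irrelevant; it only makes the projection π onto the nets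
  -- total.
  have hpar : ∀ k v, ∃ c, ‖v‖ ≤ 1 → c ∈ T k ∧ ‖v - c‖ ≤ (1 / 8) ^ k := fun k v => by
    by_cases hv : ‖v‖ ≤ 1
    · obtain ⟨c, h1, h2⟩ := hTn k v hv
      exact ⟨c, fun _ => ⟨h1, h2⟩⟩
    · exact ⟨0, fun h => absurd h hv⟩
  choose π hπ using hpar
  -- Error budget: nt/2 on the coarsest net and nt·2^{-(k+2)} on the link from scale 8^{-(k+2)} to
  -- 8^{-(k+1)}, in total nt. The failure probabilities are split in the same proportions.
  let A : Set Ω := ⋃ v ∈ T 1, {w | n * t / 2 < |D v w|}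
  let B : ℕ → Set Ω := fun k =>
    ⋃ v ∈ T (k + 2), {w | n * t * (1 / 2) ^ (k + 2) < |D v w - D (π (k + 1) v) w|}
  set x : ℝ := n * t ^ 2 with hx_def
  set C : ℝ := 2 * Real.exp (-(x / 8)) with hC
  have hC0 : 0 ≤ C := by positivity
  have hunion : ∀ (T' : Finset E) (G : E → Set Ω) (b c : ℝ), 0 ≤ b → (T'.card : ℝ) ≤ c →
      (∀ v ∈ T', P (G v) ≤ ENNReal.ofReal b) → P (⋃ v ∈ T', G v) ≤ ENNReal.ofReal (c * b) := by
    intro T' G b c hb hc hG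
    calc P (⋃ v ∈ T', G v) ≤ ∑ v ∈ T', P (G v) := measure_biUnion_finset_le _ _
      _ ≤ ∑ v ∈ T', ENNReal.ofReal b := Finset.sum_le_sum hG
      _ = ENNReal.ofReal (T'.card * b) := by
        rw [Finset.sum_const, nsmul_eq_mul, ENNReal.ofReal_mul (by positivity),
          ENNReal.ofReal_natCast]
      _ ≤ _ := ENNReal.ofReal_le_ofReal (by gcongr)
  have hA : P A ≤ ENNReal.ofReal (C * (1 / 2) ^ 1) := by
    refine (hunion (T 1) _ (2 * Real.exp (-(x / 2))) _ (by positivity) (hcard 1) ?_).trans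
      (ENNReal.ofReal_le_ofReal ?_)
    · intro v hv
      refine (hoeffding_two_sided P hZ hindep hlaw (hF v) (a := 0) (b := 1)
        (fun z => ⟨hF0 v z, (hF1 v z).trans (hT1 1 v hv)⟩) s
        (u := n * t / 2) (by positivity)).trans (le_of_eq ?_)
      rw [← hn_def, hx_def]
      congr 4
      field_simp
      ring
    · rw [pow_one (1 / 8 : ℝ)]
      exact chaining_first_level hM hx
  have hB : ∀ k, P (B k) ≤ ENNReal.ofReal (C * (1 / 2) ^ (k + 2)) := by
    intro k
    refine (hunion (T (k + 2)) _ (2 * Real.exp (-(x * 16 ^ (k + 1) / 8))) _ (by positivity)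
      (hcard (k + 2)) ?_).trans (ENNReal.ofReal_le_ofReal (chaining_later_level hM hx k))
    intro v hv
    have hvπ := (hπ (k + 1) v (hT1 _ v hv)).2
    -- A link has range of width 2·8^{-(k+1)}, so the Hoeffding exponent is 2n²t²4^{-(k+2)} /
    -- (4n·64^{-(k+1)}) = x·16^{k+1}/8: scales shrink by 8, the budget only by 2.
    have hH := hoeffding_two_sided P hZ hindep hlaw
        (h := fun z => F v z - F (π (k + 1) v) z) ((hF v).sub (hF _))
        (a := -(1 / 8) ^ (k + 1)) (b := (1 / 8) ^ (k + 1))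
        (fun z => abs_le.1 ((hlip _ _ z).trans hvπ)) s
        (u := n * t * (1 / 2) ^ (k + 2)) (by positivity)
    rw [integral_sub (hint _) (hint _), ← hn_def] at hH
    have hset : {w | n * t * (1 / 2) ^ (k + 2) < |D v w - D (π (k + 1) v) w|} =
        {w | n * t * (1 / 2) ^ (k + 2) < |∑ i ∈ s, (F v (Z i w) - F (π (k + 1) v) (Z i w)) -
          n * (∫ z, F v z ∂κ - ∫ z, F (π (k + 1) v) z ∂κ)|} := by
      ext w
      have : D v w - D (π (k + 1) v) w = ∑ i ∈ s, (F v (Z i w) - F (π (k + 1) v) (Z i w)) -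
          n * (∫ z, F v z ∂κ - ∫ z, F (π (k + 1) v) z ∂κ) := by
        simp only [D, Finset.sum_sub_distrib]
        ring
      rw [Set.mem_ofPred_eq, Set.mem_ofPred_eq, this]
    rw [hset]
    refine hH.trans (le_of_eq ?_)
    congr 4
    rw [hx_def, sub_neg_eq_add, ← two_mul, mul_pow, mul_pow, mul_pow, ← pow_mul, ← pow_mul,
      mul_comm (k + 2) 2, mul_comm (k + 1) 2, pow_mul, pow_mul, pow_succ _ (k + 1)]
    rw [show ((1 / 2 : ℝ) ^ 2) = 16 * (1 / 8) ^ 2 by norm_num, mul_pow (16 : ℝ)]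
    field_simp
    ring
  refine ⟨A ∪ ⋃ k, B k, ?_, ?_, ?_⟩
  · refine MeasurableSet.union ?_ (MeasurableSet.iUnion fun k => ?_)
    · exact Finset.measurableSet_biUnion _ fun v _ =>
        measurableSet_lt measurable_const (continuous_abs.measurable.comp (hDm v))
    · exact Finset.measurableSet_biUnion _ fun v _ =>
        measurableSet_lt measurable_const
          (continuous_abs.measurable.comp ((hDm v).sub (hDm _)))
  · have hsum : Summable fun k : ℕ => C * (1 / 2 : ℝ) ^ (k + 2) :=
      ((summable_nat_add_iff 2).2 summable_geometric_two).mul_left C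
    calc P (A ∪ ⋃ k, B k) ≤ P A + P (⋃ k, B k) := measure_union_le _ _
      _ ≤ P A + ∑' k, P (B k) := by gcongr; exact measure_iUnion_le _
      _ ≤ ENNReal.ofReal (C * (1 / 2) ^ 1) + ∑' k : ℕ, ENNReal.ofReal (C * (1 / 2) ^ (k + 2)) := by
        gcongr with k
        exact hB k
      _ = ENNReal.ofReal (C * (1 / 2) ^ 1 + ∑' k : ℕ, C * (1 / 2) ^ (k + 2)) := by
        rw [← ENNReal.ofReal_tsum_of_nonneg (fun k => by positivity) hsum,
          ← ENNReal.ofReal_add (by positivity) (tsum_nonneg fun k => by positivity)]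
      _ = ENNReal.ofReal C := by
        congr 1
        have : ∑' k : ℕ, (1 / 2 : ℝ) ^ (k + 2) = 1 / 2 := by
          simp_rw [pow_add]
          rw [tsum_mul_right, tsum_geometric_two]
          norm_num
        rw [tsum_mul_left, this]
        ring
  · intro w hw v hv
    simp only [Set.mem_union, Set.mem_iUnion, not_or, not_exists, A, B, Set.mem_ofPred_eq,
      not_lt] at hw
    obtain ⟨hwA, hwB⟩ := hw
    have hchain : ∀ k, ∀ u ∈ T (k + 1), |D u w| ≤ n * t * (1 - (1 / 2) ^ (k + 1)) := by
      intro k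
      induction k with
      | zero =>
        intro u hu
        refine (hwA u hu).trans (le_of_eq ?_)
        norm_num
        ring
      | succ k ih =>
        intro u hu
        have h1 := hwB k u hu
        have h2 := ih _ (hπ (k + 1) u (hT1 _ u hu)).1
        have h3 := abs_add_le (D u w - D (π (k + 1) u) w) (D (π (k + 1) u) w)
        rw [sub_add_cancel] at h3
        refine h3.trans ((add_le_add h1 h2).trans (le_of_eq ?_))
        rw [pow_succ _ (k + 1)]
        ring
    have hDlip : ∀ u v, |D u w - D v w| ≤ 2 * n * ‖u - v‖ := by
      intro u v
      have h1 : |∑ i ∈ s, (F u (Z i w) - F v (Z i w))| ≤ n * ‖u - v‖ := by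
        refine (Finset.abs_sum_le_sum_abs _ _).trans ?_
        refine (Finset.sum_le_sum fun i _ => hlip u v _).trans (le_of_eq ?_)
        rw [Finset.sum_const, nsmul_eq_mul]
      have h2 : |∫ z, F u z ∂κ - ∫ z, F v z ∂κ| ≤ ‖u - v‖ := by
        rw [← integral_sub (hint u) (hint v)]
        have := norm_integral_le_of_norm_le_const (μ := κ) (f := fun z => F u z - F v z)
          (C := ‖u - v‖) (Filter.Eventually.of_forall fun z => hlip u v z)
        simpa using this
      have h3 : D u w - D v w = ∑ i ∈ s, (F u (Z i w) - F v (Z i w)) -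
          n * (∫ z, F u z ∂κ - ∫ z, F v z ∂κ) := by
        simp only [D, Finset.sum_sub_distrib]
        ring
      rw [h3]
      refine (abs_sub _ _).trans ?_
      rw [abs_mul, abs_of_pos hn]
      nlinarith
    -- From the nets to the whole ball: the crude Lipschitz constant 2n suffices because the net
    -- scale tends to 0.
    have hlim : ∀ k : ℕ, |D v w| ≤ n * t + 2 * n * (1 / 8) ^ (k + 1) := by
      intro k
      obtain ⟨c, hc, hvc⟩ := hTn (k + 1) v hv
      have h1 := hchain k c hc
      have h2 := (hDlip v c).trans (mul_le_mul_of_nonneg_left hvc (by positivity))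
      have h3 := abs_add_le (D v w - D c w) (D c w)
      rw [sub_add_cancel] at h3
      have h4 : n * t * (1 - (1 / 2) ^ (k + 1)) ≤ n * t := by
        apply mul_le_of_le_one_right (by positivity)
        have : (0 : ℝ) ≤ (1 / 2) ^ (k + 1) := by positivity
        linarith
      linarith
    have htend : Filter.Tendsto (fun k : ℕ => n * t + 2 * n * (1 / 8 : ℝ) ^ (k + 1)) Filter.atTop
        (nhds (n * t + 2 * n * 0)) := by
      refine Filter.Tendsto.const_add _ (Filter.Tendsto.const_mul _ ?_)
      exact (tendsto_pow_atTop_nhds_zero_of_lt_one (by norm_num) (by norm_num)).comp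
        (Filter.tendsto_add_atTop_nat 1)
    have := ge_of_tendsto' htend hlim
    rwa [mul_zero, add_zero] at this

end MixedSampling

/-! ### Lattice sums of translated weights -/

namespace MixedSampling

/-- A sum over `ℤ^d` of products of functions of the coordinates is the product of the sums. -/
lemma tsum_pi_prod {β : Type*} : ∀ (d : ℕ) (f : Fin d → β → ℝ≥0∞),
    ∑' k : Fin d → β, ∏ i, f i (k i) = ∏ i, ∑' n, f i n
  | 0, f => by
    rw [tsum_eq_single default fun b hb => absurd (Subsingleton.elim b default) hb]
    simp
  | d + 1, f => by
    rw [← (Fin.consEquiv fun _ : Fin (d + 1) => β).tsum_eq, ENNReal.tsum_prod', Fin.prod_univ_succ,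
      ← tsum_pi_prod d, ← ENNReal.tsum_mul_right]
    refine tsum_congr fun n => ?_
    rw [← ENNReal.tsum_mul_left]
    refine tsum_congr fun k => ?_
    simp [Fin.consEquiv, Fin.prod_univ_succ]

/-- The sum of a Gaussian over a translate of `ℤ` is largest for `ℤ` itself. -/
lemma tsum_gaussian_int_le {u : ℝ} (hu : 0 < u) (y : ℝ) :
    ∑' n : ℤ, ENNReal.ofReal (Real.exp (-(u * |y - n| ^ 2))) ≤
      ∑' n : ℤ, ENNReal.ofReal (Real.exp (-(u * |(n : ℝ)| ^ 2))) := by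
  -- The theta kernel is normalised as a sum of exp(-π(n+a)²x), so x = u/π.
  have hx : 0 < u / Real.pi := by positivity
  have key : ∀ y : ℝ, HasSum (fun n : ℤ => Real.exp (-(u * |y - n| ^ 2)))
      (HurwitzZeta.evenKernel ((-y : ℝ) : UnitAddCircle) (u / Real.pi)) := by
    intro y
    refine (HurwitzZeta.hasSum_int_evenKernel (-y) hx).congr_fun ?_
    intro n
    congr 1
    rw [sq_abs]
    field_simp
    ring
  have h0 : ∀ n : ℤ, Real.exp (-(u * |(n : ℝ)| ^ 2)) = Real.exp (-(u * |(0 : ℝ) - n| ^ 2)) :=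
    fun n => by rw [zero_sub, abs_neg]
  simp_rw [h0]
  rw [← ENNReal.ofReal_tsum_of_nonneg (fun n => (Real.exp_pos _).le) (key y).summable,
    ← ENNReal.ofReal_tsum_of_nonneg (fun n => (Real.exp_pos _).le) (key 0).summable,
    (key y).tsum_eq, (key 0).tsum_eq]
  apply ENNReal.ofReal_le_ofReal
  -- Poisson summation: the translate becomes a phase in a Fourier series with positive
  -- coefficients, so the triangle inequality puts the maximum at y = 0.
  rw [HurwitzZeta.evenKernel_functional_equation, HurwitzZeta.evenKernel_functional_equation]
  have ht : 0 < 1 / (u / Real.pi) := by positivity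
  have h1 := HurwitzZeta.hasSum_int_cosKernel (-y) ht
  have h2 := HurwitzZeta.hasSum_int_cosKernel (-0) ht
  have hnorm : ∀ (a : ℝ) (n : ℤ), ‖Complex.exp (2 * Real.pi * Complex.I * a * n) *
      (Real.exp (-Real.pi * n ^ 2 * (1 / (u / Real.pi))) : ℂ)‖ =
      Real.exp (-Real.pi * n ^ 2 * (1 / (u / Real.pi))) := by
    intro a n
    rw [norm_mul, Complex.norm_real, Real.norm_of_nonneg (Real.exp_pos _).le,
      show (2 * Real.pi * Complex.I * a * n : ℂ) = ((2 * Real.pi * a * n : ℝ) : ℂ) * Complex.I by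
        push_cast; ring, Complex.norm_exp_ofReal_mul_I, one_mul]
  have hle : HurwitzZeta.cosKernel ((-y : ℝ) : UnitAddCircle) (1 / (u / Real.pi)) ≤
      HurwitzZeta.cosKernel ((-0 : ℝ) : UnitAddCircle) (1 / (u / Real.pi)) := by
    have h3 : HasSum (fun n : ℤ => Real.exp (-Real.pi * n ^ 2 * (1 / (u / Real.pi))))
        (HurwitzZeta.cosKernel ((-0 : ℝ) : UnitAddCircle) (1 / (u / Real.pi))) := by
      rw [← Complex.hasSum_ofReal]
      simpa using h2
    have h4 := norm_tsum_le_tsum_norm (f := fun n : ℤ => Complex.exp (2 * Real.pi * Complex.I *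
      ((-y : ℝ) : ℂ) * n) * (Real.exp (-Real.pi * n ^ 2 * (1 / (u / Real.pi))) : ℂ))
      (by simp_rw [hnorm]; exact h3.summable)
    simp_rw [hnorm] at h4
    rw [h3.tsum_eq] at h4
    refine le_trans (le_trans (le_abs_self _) (le_of_eq ?_)) h4
    rw [h1.tsum_eq, Complex.norm_real, Real.norm_eq_abs]
  gcongr

/-- The sum of a Gaussian over a translate of `ℤ^d` is largest for `ℤ^d` itself. -/
lemma tsum_gaussian_latt_le {d : ℕ} {u : ℝ} (hu : 0 < u) (y : EuclideanSpace ℝ (Fin d)) :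
    ∑' k : Fin d → ℤ, ENNReal.ofReal (Real.exp (-(u * ‖y - latt k‖ ^ 2))) ≤
      ∑' k : Fin d → ℤ, ENNReal.ofReal (Real.exp (-(u * ‖latt k‖ ^ 2))) := by
  have hprod : ∀ (y : EuclideanSpace ℝ (Fin d)),
      ENNReal.ofReal (Real.exp (-(u * ‖y‖ ^ 2))) =
      ∏ i, ENNReal.ofReal (Real.exp (-(u * |y i| ^ 2))) := by
    intro y
    rw [← ENNReal.ofReal_prod_of_nonneg fun i _ => (Real.exp_pos _).le, ← Real.exp_sum,
      EuclideanSpace.norm_sq_eq, Finset.mul_sum, Finset.sum_neg_distrib]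
    rfl
  simp_rw [hprod]
  have h1 := tsum_pi_prod d fun i (n : ℤ) => ENNReal.ofReal (Real.exp (-(u * |y i - n| ^ 2)))
  have h2 := tsum_pi_prod d fun _ (n : ℤ) => ENNReal.ofReal (Real.exp (-(u * |(n : ℝ)| ^ 2)))
  calc _ = _ := h1
    _ ≤ _ := Finset.prod_le_prod' fun i _ => tsum_gaussian_int_le hu (y i)
    _ = _ := h2.symm

/-- The Cauchy–Schlömilch transformation of the Gaussian integral. -/
lemma lintegral_exp_neg_sq_sub_div {b : ℝ} (hb : 0 ≤ b) :
    ∫⁻ w in Set.Ioi (0 : ℝ), ENNReal.ofReal (Real.exp (-(w - b / w) ^ 2)) =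
      ENNReal.ofReal (√Real.pi / 2) := by
  have hint : ∀ (s : Set ℝ) (c : ℝ), 0 < c → ∫ w in s, Real.exp (-1 * w ^ 2) = c →
      ∫⁻ w in s, ENNReal.ofReal (Real.exp (-w ^ 2)) = ENNReal.ofReal c := by
    intro s c hc h
    rw [← h, ofReal_integral_eq_lintegral_ofReal]
    · simp
    · exact Integrable.of_integral_ne_zero (h ▸ hc.ne')
    · exact Filter.Eventually.of_forall fun w => (Real.exp_pos _).le
  -- For b = 0 the map w ↦ w - b/w sends (0,∞) only onto (0,∞), and the half-line Gaussian integral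
  -- is read off directly.
  rcases hb.eq_or_lt with rfl | hb
  · simp only [zero_div, sub_zero]
    exact hint _ _ (by positivity) (by rw [integral_gaussian_Ioi, div_one])
  have hR : ∀ z : ℝ, 0 < z ^ 2 + 4 * b := fun z => by positivity
  have hlt : ∀ z : ℝ, |z| < √(z ^ 2 + 4 * b) := fun z => by
    rw [← Real.sqrt_sq_eq_abs]
    exact Real.sqrt_lt_sqrt (sq_nonneg z) (by linarith)
  -- For b > 0 this is the inverse of w ↦ w - b/w from (0,∞) onto ℝ, the positive root of w² - zw -
  -- b = 0.
  let W : ℝ → ℝ := fun z => (z + √(z ^ 2 + 4 * b)) / 2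
  have hWpos : ∀ z, 0 < W z := fun z => by
    have := (abs_lt.1 (hlt z)).1
    simp only [W]
    linarith
  have hWinv : ∀ z, W z - b / W z = z := fun z => by
    have h1 : W z * W z = z * W z + b := by
      have := Real.mul_self_sqrt (hR z).le
      simp only [W]
      nlinarith
    have := (hWpos z).ne'
    field_simp
    linarith
  have hWimg : W '' Set.univ = Set.Ioi 0 := by
    ext w
    constructor
    · rintro ⟨z, -, rfl⟩
      exact hWpos z
    · intro hw
      have hw : 0 < w := hw
      refine ⟨w - b / w, trivial, ?_⟩
      have : (w - b / w) ^ 2 + 4 * b = (w + b / w) ^ 2 := by field_simp; ring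
      simp only [W]
      rw [this, Real.sqrt_sq (by positivity)]
      ring
  have hWder : ∀ z ∈ Set.univ, HasDerivWithinAt W ((1 + z / √(z ^ 2 + 4 * b)) / 2) Set.univ z := by
    intro z _
    have h1 : HasDerivAt (fun z : ℝ => z ^ 2 + 4 * b) (2 * z) z := by
      simpa using (hasDerivAt_pow 2 z).add_const (4 * b)
    have h2 := ((hasDerivAt_id z).add (h1.sqrt (hR z).ne')).div_const 2
    refine (h2.congr_deriv ?_).hasDerivWithinAt
    congr 2
    exact mul_div_mul_left _ _ two_ne_zero
  have hWinj : Set.InjOn W Set.univ := fun z _ z' _ h => by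
    rw [← hWinv z, ← hWinv z', h]
  have hsub := lintegral_image_eq_lintegral_abs_deriv_mul MeasurableSet.univ hWder hWinj
    fun w => ENNReal.ofReal (Real.exp (-(w - b / w) ^ 2))
  rw [hWimg, Measure.restrict_univ] at hsub
  have hcoef : ∀ z : ℝ, 0 ≤ (1 + z / √(z ^ 2 + 4 * b)) / 2 := fun z => by
    have h1 : 0 < √(z ^ 2 + 4 * b) := (abs_nonneg z).trans_lt (hlt z)
    have h2 : -1 ≤ z / √(z ^ 2 + 4 * b) := by
      rw [le_div_iff₀ h1]
      linarith [(abs_lt.1 (hlt z)).1]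
    linarith
  simp_rw [hWinv, abs_of_nonneg (hcoef _)] at hsub
  set J := ∫⁻ w in Set.Ioi (0 : ℝ), ENNReal.ofReal (Real.exp (-(w - b / w) ^ 2))
  -- The Jacobians at z and -z add up to 1, so averaging with the reflection leaves half of the full
  -- Gaussian integral, independently of b.
  have hrefl : J = ∫⁻ z : ℝ, ENNReal.ofReal ((1 + (-z) / √(z ^ 2 + 4 * b)) / 2) *
      ENNReal.ofReal (Real.exp (-z ^ 2)) := by
    rw [hsub, ← lintegral_neg_eq_self]
    simp
  have htwo : J + J = ENNReal.ofReal √Real.pi := by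
    nth_rewrite 1 [hsub]
    rw [hrefl, ← lintegral_add_left (by fun_prop)]
    have : ∀ z : ℝ, ENNReal.ofReal ((1 + z / √(z ^ 2 + 4 * b)) / 2) *
        ENNReal.ofReal (Real.exp (-z ^ 2)) + ENNReal.ofReal ((1 + -z / √(z ^ 2 + 4 * b)) / 2) *
        ENNReal.ofReal (Real.exp (-z ^ 2)) = ENNReal.ofReal (Real.exp (-z ^ 2)) := by
      intro z
      have h' := hcoef (-z)
      rw [neg_sq] at h'
      rw [← add_mul, ← ENNReal.ofReal_add (hcoef z) h']
      have : (1 + z / √(z ^ 2 + 4 * b)) / 2 + (1 + -z / √(z ^ 2 + 4 * b)) / 2 = 1 := by ring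
      rw [this, ENNReal.ofReal_one, one_mul]
    simp_rw [this]
    have := hint Set.univ √Real.pi (by positivity)
      (by rw [Measure.restrict_univ, integral_gaussian, div_one])
    rwa [Measure.restrict_univ] at this
  have hJ : 2 * J = 2 * ENNReal.ofReal (√Real.pi / 2) := by
    rw [two_mul, htwo, ← ENNReal.ofReal_ofNat, ← ENNReal.ofReal_mul (by norm_num)]
    congr 1
    ring
  exact (ENNReal.mul_right_inj two_ne_zero ENNReal.ofNat_ne_top).1 hJ

/-- The exponential function `e^{-R}` is a mixture of Gaussians. -/
lemma lintegral_gaussian_mixture {R : ℝ} (hR : 0 ≤ R) :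
    ∫⁻ w in Set.Ioi (0 : ℝ), ENNReal.ofReal (Real.exp (-w ^ 2)) *
        ENNReal.ofReal (Real.exp (-(1 / (4 * w ^ 2) * R ^ 2))) =
      ENNReal.ofReal (√Real.pi / 2) * ENNReal.ofReal (Real.exp (-R)) := by
  -- Completing the square: w² + R²/(4w²) = (w - R/(2w))² + R.
  rw [← lintegral_exp_neg_sq_sub_div (b := R / 2) (by positivity), ← lintegral_mul_const'
    _ _ ENNReal.ofReal_ne_top]
  refine setLIntegral_congr_fun measurableSet_Ioi fun w hw => ?_
  have hw : (0 : ℝ) < w := hw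
  rw [← ENNReal.ofReal_mul (Real.exp_pos _).le, ← ENNReal.ofReal_mul (Real.exp_pos _).le,
    ← Real.exp_add, ← Real.exp_add]
  congr 2
  field_simp
  ring

/-- The function `(1 + R)^{-t}` is a mixture of exponentials. -/
lemma lintegral_exponential_mixture {R t : ℝ} (hR : 0 ≤ R) (ht : 0 < t) :
    ∫⁻ s in Set.Ioi (0 : ℝ), ENNReal.ofReal (s ^ (t - 1) * Real.exp (-s)) *
        ENNReal.ofReal (Real.exp (-(s * R))) =
      ENNReal.ofReal (Real.Gamma t) * ENNReal.ofReal (1 / (1 + R) ^ t) := by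
  have h1 := Real.integral_rpow_mul_exp_neg_mul_Ioi (r := 1 + R) ht (by positivity)
  have hG := Real.Gamma_pos_of_pos ht
  have hpos : 0 < (1 / (1 + R)) ^ t * Real.Gamma t := by positivity
  rw [← ENNReal.ofReal_mul hG.le, mul_comm (Real.Gamma t),
    ← Real.one_rpow t, ← Real.div_rpow zero_le_one (by positivity), Real.one_rpow, ← h1,
    ofReal_integral_eq_lintegral_ofReal]
  · refine setLIntegral_congr_fun measurableSet_Ioi fun s hs => ?_
    have hs : (0 : ℝ) < s := hs
    rw [← ENNReal.ofReal_mul (by positivity), mul_assoc, ← Real.exp_add]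
    congr 3
    ring
  · exact Integrable.of_integral_ne_zero (h1 ▸ hpos.ne')
  · refine (ae_restrict_iff' measurableSet_Ioi).2 (Filter.Eventually.of_forall fun s hs => ?_)
    have hs : (0 : ℝ) < s := hs
    simp only [Pi.zero_apply]
    positivity

/-- Domination of Gaussian sums implies domination of the sums of negative powers. -/
lemma tsum_rpow_le_of_gaussian {κ : Type*} [Countable κ] {a b : κ → ℝ} (ha : ∀ k, 0 ≤ a k)
    (hb : ∀ k, 0 ≤ b k)
    (hG : ∀ u : ℝ, 0 < u → ∑' k, ENNReal.ofReal (Real.exp (-(u * a k ^ 2))) ≤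
      ∑' k, ENNReal.ofReal (Real.exp (-(u * b k ^ 2)))) {t : ℝ} (ht : 0 < t) :
    ∑' k, ENNReal.ofReal (1 / (1 + a k) ^ t) ≤ ∑' k, ENNReal.ofReal (1 / (1 + b k) ^ t) := by
  have hexp : ∀ s : ℝ, 0 < s → ∑' k, ENNReal.ofReal (Real.exp (-(s * a k))) ≤
      ∑' k, ENNReal.ofReal (Real.exp (-(s * b k))) := by
    intro s hs
    -- The mixing weights are nonnegative and do not depend on k, so the comparison for every
    -- Gaussian parameter u survives the integration over w.
    have hmix : ∀ c : κ → ℝ, (∀ k, 0 ≤ c k) → ENNReal.ofReal (√Real.pi / 2) *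
        ∑' k, ENNReal.ofReal (Real.exp (-(s * c k))) =
        ∫⁻ w in Set.Ioi (0 : ℝ), ENNReal.ofReal (Real.exp (-w ^ 2)) *
          ∑' k, ENNReal.ofReal (Real.exp (-(s ^ 2 / (4 * w ^ 2) * c k ^ 2))) := by
      intro c hc
      simp_rw [← ENNReal.tsum_mul_left]
      rw [lintegral_tsum fun k => by fun_prop]
      refine tsum_congr fun k => ?_
      rw [← lintegral_gaussian_mixture (mul_nonneg hs.le (hc k))]
      refine lintegral_congr fun w => ?_
      congr 3
      ring
    have hpi : ENNReal.ofReal (√Real.pi / 2) ≠ 0 := by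
      rw [Ne, ENNReal.ofReal_eq_zero, not_le]
      positivity
    refine (ENNReal.mul_le_mul_iff_right hpi ENNReal.ofReal_ne_top).1 ?_
    rw [hmix a ha, hmix b hb]
    refine setLIntegral_mono' measurableSet_Ioi fun w hw => ?_
    have hw : (0 : ℝ) < w := hw
    exact mul_le_mul' le_rfl (hG _ (by positivity))
  have hmix : ∀ c : κ → ℝ, (∀ k, 0 ≤ c k) → ENNReal.ofReal (Real.Gamma t) *
      ∑' k, ENNReal.ofReal (1 / (1 + c k) ^ t) =
      ∫⁻ s in Set.Ioi (0 : ℝ), ENNReal.ofReal (s ^ (t - 1) * Real.exp (-s)) *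
        ∑' k, ENNReal.ofReal (Real.exp (-(s * c k))) := by
    intro c hc
    simp_rw [← ENNReal.tsum_mul_left]
    rw [lintegral_tsum fun k => by fun_prop]
    exact tsum_congr fun k => (lintegral_exponential_mixture (hc k) ht).symm
  have hG' : ENNReal.ofReal (Real.Gamma t) ≠ 0 := by
    rw [Ne, ENNReal.ofReal_eq_zero, not_le]
    exact Real.Gamma_pos_of_pos ht
  refine (ENNReal.mul_le_mul_iff_right hG' ENNReal.ofReal_ne_top).1 ?_
  rw [hmix a ha, hmix b hb]
  refine setLIntegral_mono' measurableSet_Ioi fun s hs => ?_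
  exact mul_le_mul' le_rfl (hexp s hs)

/-- The lattice sum of `(1 + |x - k|)^{-t}` over `k ∈ ℤ` is largest at `x = 0`. -/
lemma tsum_int_rpow_le {t : ℝ} (ht : 0 < t) (x : ℝ) :
    ∑' k : ℤ, ENNReal.ofReal (1 / (1 + |x - k|) ^ t) ≤
      ∑' k : ℤ, ENNReal.ofReal (1 / (1 + |(k : ℝ)|) ^ t) :=
  tsum_rpow_le_of_gaussian (fun _ => abs_nonneg _) (fun _ => abs_nonneg _)
    (fun _ hu => tsum_gaussian_int_le hu x) ht

/-- The maximum norm of a multi-index is at most its Euclidean norm. -/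
lemma norm_le_norm_latt {d : ℕ} (k : Fin d → ℤ) : ‖k‖ ≤ ‖latt k‖ := by
  rw [pi_norm_le_iff_of_nonneg (norm_nonneg _)]
  intro i
  have := PiLp.norm_apply_le (latt k) i
  simpa [latt, Int.norm_eq_abs] using this

/-- The lattice sum of `(1 + |y - k|)^{-t}` over `k ∈ ℤ^d` is at most the one of
`(1 + |k|_∞)^{-t}`. -/
lemma tsum_latt_rpow_le {d : ℕ} {t : ℝ} (ht : 0 < t) (y : EuclideanSpace ℝ (Fin d)) :
    ∑' k : Fin d → ℤ, ENNReal.ofReal (1 / (1 + ‖y - latt k‖) ^ t) ≤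
      ∑' k : Fin d → ℤ, ENNReal.ofReal (1 / (1 + ‖k‖) ^ t) := by
  refine (tsum_rpow_le_of_gaussian (fun _ => norm_nonneg _) (fun _ => norm_nonneg _)
    (fun _ hu => tsum_gaussian_latt_le hu y) ht).trans (ENNReal.tsum_le_tsum fun k => ?_)
  apply ENNReal.ofReal_le_ofReal
  gcongr
  exact norm_le_norm_latt k

lemma summable_int_rpow {t : ℝ} (ht : 1 < t) :
    Summable fun k : ℤ => 1 / (1 + |(k : ℝ)|) ^ t := by
  have h := (Real.summable_one_div_int_add_rpow 1 t).2 ht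
  refine Summable.of_nat_of_neg ?_ ?_
  · have := h.comp_injective Nat.cast_injective (i := ((↑) : ℕ → ℤ))
    refine this.congr fun n => ?_
    have : (0 : ℝ) ≤ n := Nat.cast_nonneg n
    simp only [Function.comp, Int.cast_natCast]
    rw [abs_of_nonneg (by positivity : (0 : ℝ) ≤ n + 1), abs_of_nonneg this, add_comm]
  · have := h.comp_injective Nat.cast_injective (i := ((↑) : ℕ → ℤ))
    refine this.congr fun n => ?_
    have : (0 : ℝ) ≤ n := Nat.cast_nonneg n
    simp only [Function.comp, Int.cast_natCast, Int.cast_neg, abs_neg]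
    rw [abs_of_nonneg (by positivity : (0 : ℝ) ≤ n + 1), abs_of_nonneg this, add_comm]

/-- Since each |k_i| ≤ |k|_∞, the weight is at most the product of the (1+|k_i|)^{-t/d}; this
factorises the sum into one-dimensional ones with exponent t/d > 1. -/
lemma summable_latt_rpow {d : ℕ} (hd : 1 ≤ d) {t : ℝ} (ht : (d : ℝ) < t) :
    Summable fun k : Fin d → ℤ => 1 / (1 + ‖k‖) ^ t := by
  have hd' : (0 : ℝ) < d := by exact_mod_cast hd
  have h1 : 1 < t / d := by rwa [lt_div_iff₀ hd', one_mul]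
  have hle : ∀ k : Fin d → ℤ, ENNReal.ofReal (1 / (1 + ‖k‖) ^ t) ≤
      ∏ i, ENNReal.ofReal (1 / (1 + |(k i : ℝ)|) ^ (t / d)) := by
    intro k
    rw [← ENNReal.ofReal_prod_of_nonneg fun i _ => by positivity]
    apply ENNReal.ofReal_le_ofReal
    calc 1 / (1 + ‖k‖) ^ t = ∏ i : Fin d, 1 / (1 + ‖k‖) ^ (t / d) := by
          rw [Finset.prod_const, Finset.card_univ, Fintype.card_fin, one_div_pow,
            ← Real.rpow_natCast, ← Real.rpow_mul (by positivity), div_mul_cancel₀ _ hd'.ne']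
      _ ≤ _ := by
          refine Finset.prod_le_prod (fun i _ => by positivity) fun i _ => ?_
          have := norm_le_pi_norm k i
          rw [Int.norm_eq_abs] at this
          gcongr
  have hfin : ∑' k : Fin d → ℤ, ENNReal.ofReal (1 / (1 + ‖k‖) ^ t) ≠ ∞ := by
    refine ne_top_of_le_ne_top ?_ (ENNReal.tsum_le_tsum hle)
    rw [tsum_pi_prod d fun _ (n : ℤ) => ENNReal.ofReal (1 / (1 + |(n : ℝ)|) ^ (t / d)),
      ← ENNReal.ofReal_tsum_of_nonneg (fun n => by positivity) (summable_int_rpow h1)]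
    exact ENNReal.prod_ne_top fun i _ => ENNReal.ofReal_ne_top
  refine (ENNReal.summable_toReal hfin).congr fun k => ?_
  rw [ENNReal.toReal_ofReal (by positivity)]

end MixedSampling

/-! ### The sup bound on V_N -/

namespace MixedSampling

/-- Hölder's inequality for sums over a countable set. -/
lemma tsum_mul_le_Lp_mul_Lq {κ : Type*} [Countable κ] {p q : ℝ} (hpq : p.HolderConjugate q)
    (f g : κ → ℝ≥0∞) :
    ∑' k, f k * g k ≤ (∑' k, f k ^ p) ^ (1 / p) * (∑' k, g k ^ q) ^ (1 / q) := by
  let _ : MeasurableSpace κ := ⊤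
  have := ENNReal.lintegral_mul_le_Lp_mul_Lq (Measure.count (α := κ)) hpq (f := f) (g := g)
    (measurable_from_top.aemeasurable) (measurable_from_top.aemeasurable)
  simpa only [lintegral_count, Pi.mul_apply] using this

variable {d r : ℕ} {p q α₁ α₂ ct s₁ s₂ : ℝ} {φ : Fin r → Pt d → ℂ}

/-- The decay threshold splits as (1-1/p) + d(1-1/q) with both summands nonnegative. Dropping the
second gives this bound, dropping the first gives `dim_lt_decay_exponent_two`; they are the
summability conditions for the conjugate powers of the weights. -/
lemma one_lt_decay_exponent_one (hp : 1 < p) (hq : 1 < q) (h : (d : ℝ) + 1 - 1 / p - d / q < s₁) :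
    1 < s₁ * p / (p - 1) := by
  have h1 : 0 < p - 1 := by linarith
  have h2 : 0 < q - 1 := by linarith
  have h3 : (0 : ℝ) ≤ d * ((q - 1) / q) := by positivity
  have h4 : (d : ℝ) + 1 - 1 / p - d / q = (p - 1) / p + d * ((q - 1) / q) := by field_simp; ring
  have h5 : (p - 1) / p < s₁ := by linarith
  rw [lt_div_iff₀ h1, one_mul]
  rwa [div_lt_iff₀ (by linarith)] at h5

lemma dim_lt_decay_exponent_two (hp : 1 < p) (hq : 1 < q)
    (h : (d : ℝ) + 1 - 1 / p - d / q < s₂) : (d : ℝ) < s₂ * q / (q - 1) := by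
  have h1 : 0 < p - 1 := by linarith
  have h2 : 0 < q - 1 := by linarith
  have h3 : 0 < (p - 1) / p := by positivity
  have h4 : (d : ℝ) + 1 - 1 / p - d / q = (p - 1) / p + d * (q - 1) / q := by field_simp; ring
  have h5 : d * (q - 1) / q < s₂ := by linarith
  rw [lt_div_iff₀ h2]
  rwa [div_lt_iff₀ (by linarith)] at h5

/-- The constant of the embedding of `V_N` into `L^∞` given by Hölder's inequality. -/
noncomputable def embConst (d : ℕ) (p q ct s₁ s₂ : ℝ) : ℝ :=
  ct * (∑' k₁ : ℤ, 1 / (1 + |(k₁ : ℝ)|) ^ (s₁ * p / (p - 1))) ^ ((p - 1) / p)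
    * (∑' k₂ : Fin d → ℤ, 1 / (1 + ‖k₂‖) ^ (s₂ * q / (q - 1))) ^ ((q - 1) / q)

lemma embConst_pos (hd : 1 ≤ d) (hp : 1 < p) (hq : 1 < q)
    (hφ : Generators p q α₁ α₂ ct s₁ s₂ φ) : 0 < embConst d p q ct s₁ s₂ := by
  have h1 := (summable_int_rpow (one_lt_decay_exponent_one hp hq hφ.s_one_gt)).tsum_pos
    (fun k => by positivity) 0 (by simp)
  have h2 := (summable_latt_rpow hd (dim_lt_decay_exponent_two hp hq hφ.s_two_gt)).tsum_pos
    (fun k => by positivity) 0 (by simp)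
  have := hφ.ct_pos
  unfold embConst
  positivity

/-- The two sides differ by the factor 4/2^{1/p+1/q}, which is at least 1 because 1/p + 1/q ≤ 2. -/
lemma embConst_le_cStar (hd : 1 ≤ d) (hp : 1 < p) (hq : 1 < q)
    (hφ : Generators p q α₁ α₂ ct s₁ s₂ φ) :
    embConst d p q ct s₁ s₂ ≤ α₁ * cStar d p q α₁ ct s₁ s₂ := by
  have hE := embConst_pos hd hp hq hφ
  have hα := hφ.alpha_one_pos
  have hpow : (2 : ℝ) ^ ((p + q) / (p * q)) ≤ 4 := by
    calc (2 : ℝ) ^ ((p + q) / (p * q)) ≤ 2 ^ (2 : ℝ) := by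
          apply Real.rpow_le_rpow_of_exponent_le (by norm_num)
          rw [div_le_iff₀ (by nlinarith)]
          nlinarith
      _ = 4 := by norm_num
  have hpow0 : (0 : ℝ) < 2 ^ ((p + q) / (p * q)) := by positivity
  have : α₁ * cStar d p q α₁ ct s₁ s₂ =
      4 / 2 ^ ((p + q) / (p * q)) * embConst d p q ct s₁ s₂ := by
    unfold cStar embConst
    field_simp
  rw [this]
  exact le_mul_of_one_le_left hE.le ((one_le_div hpow0).2 hpow)

lemma cStar_pos (hd : 1 ≤ d) (hp : 1 < p) (hq : 1 < q)
    (hφ : Generators p q α₁ α₂ ct s₁ s₂ φ) : 0 < cStar d p q α₁ ct s₁ s₂ :=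
  pos_of_mul_pos_right ((embConst_pos hd hp hq hφ).trans_le (embConst_le_cStar hd hp hq hφ))
    hφ.alpha_one_pos.le

/-- A decaying weight, summed over shifts to the conjugate power, is controlled by the lattice. -/
lemma weight_sum_le {κ : Type*} {p s : ℝ} (hp : 1 < p) {a b : κ → ℝ} (ha : ∀ k, 0 ≤ a k)
    (hb : ∀ k, 0 ≤ b k) (hsum : Summable fun k => 1 / (1 + b k) ^ (s * p / (p - 1)))
    (hle : ∑' k, ENNReal.ofReal (1 / (1 + a k) ^ (s * p / (p - 1))) ≤
      ∑' k, ENNReal.ofReal (1 / (1 + b k) ^ (s * p / (p - 1)))) :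
    (∑' k, ENNReal.ofReal (1 / (1 + a k) ^ s) ^ (p / (p - 1))) ^ (1 / (p / (p - 1))) ≤
      ENNReal.ofReal ((∑' k, 1 / (1 + b k) ^ (s * p / (p - 1))) ^ ((p - 1) / p)) := by
  have hp1 : 0 < p - 1 := by linarith
  have hpow : ∀ k, ENNReal.ofReal (1 / (1 + a k) ^ s) ^ (p / (p - 1)) =
      ENNReal.ofReal (1 / (1 + a k) ^ (s * p / (p - 1))) := by
    intro k
    have := ha k
    rw [ENNReal.ofReal_rpow_of_nonneg (by positivity) (by positivity),
      Real.div_rpow zero_le_one (by positivity), Real.one_rpow, ← Real.rpow_mul (by positivity),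
      mul_div_assoc]
  have hnn : ∀ k, 0 ≤ 1 / (1 + b k) ^ (s * p / (p - 1)) := fun k => by
    have := hb k
    positivity
  simp_rw [hpow]
  rw [one_div_div, ← ENNReal.ofReal_rpow_of_nonneg (tsum_nonneg hnn) (by positivity),
    ENNReal.ofReal_tsum_of_nonneg hnn hsum]
  gcongr

lemma enorm_generator_le (hφ : Generators p q α₁ α₂ ct s₁ s₂ φ) (i : Fin r) (x : ℝ)
    (y : EuclideanSpace ℝ (Fin d)) :
    ‖φ i (x, y)‖ₑ ≤ ENNReal.ofReal ct * (ENNReal.ofReal (1 / (1 + |x|) ^ s₁) *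
      ENNReal.ofReal (1 / (1 + ‖y‖) ^ s₂)) := by
  have hct := hφ.ct_pos
  rw [← ENNReal.ofReal_mul (by positivity), ← ENNReal.ofReal_mul hct.le, ← ofReal_norm]
  apply ENNReal.ofReal_le_ofReal
  refine (hφ.decay i x y).trans (le_of_eq ?_)
  rw [div_mul_div_comm, one_mul, mul_one_div]

/-- Hölder's inequality for the series defining `synth`. -/
lemma tsum_enorm_shift_le (hd : 1 ≤ d) (hp : 1 < p) (hq : 1 < q)
    (hφ : Generators p q α₁ α₂ ct s₁ s₂ φ) (i : Fin r) (c : ℤ → (Fin d → ℤ) → ℂ) (z : Pt d) :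
    ∑' k₁ : ℤ, ∑' k₂ : Fin d → ℤ,
        ‖c k₁ k₂‖ₑ * ‖φ i (z.1 - (k₁ : ℝ), z.2 - latt k₂)‖ₑ ≤
      ENNReal.ofReal (embConst d p q ct s₁ s₂) * seqNorm p q c := by
  have hp1 : 0 < p - 1 := by linarith
  have hq1 : 0 < q - 1 := by linarith
  have e1 := one_lt_decay_exponent_one hp hq hφ.s_one_gt
  have e2 := dim_lt_decay_exponent_two hp hq hφ.s_two_gt
  have hd0 : (0 : ℝ) ≤ d := Nat.cast_nonneg d
  have hct := hφ.ct_pos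
  have w1 := weight_sum_le (s := s₁) hp (fun k : ℤ => abs_nonneg (z.1 - k))
    (fun k => abs_nonneg (k : ℝ))
    (summable_int_rpow e1) (tsum_int_rpow_le (by linarith) z.1)
  have w2 := weight_sum_le (s := s₂) hq (fun k : Fin d → ℤ => norm_nonneg (z.2 - latt k))
    (fun k => norm_nonneg k) (summable_latt_rpow hd e2) (tsum_latt_rpow_le (by linarith) z.2)
  have hcp : p.HolderConjugate (p / (p - 1)) := Real.HolderConjugate.conjExponent hp
  have hcq : q.HolderConjugate (q / (q - 1)) := Real.HolderConjugate.conjExponent hq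
  set T₁ := (∑' k₁ : ℤ, 1 / (1 + |(k₁ : ℝ)|) ^ (s₁ * p / (p - 1))) ^ ((p - 1) / p) with hT₁
  set T₂ := (∑' k₂ : Fin d → ℤ, 1 / (1 + ‖k₂‖) ^ (s₂ * q / (q - 1))) ^ ((q - 1) / q) with hT₂
  have hT₁0 : 0 ≤ T₁ := Real.rpow_nonneg (tsum_nonneg fun k => by positivity) _
  let U : ℤ → ℝ≥0∞ := fun k => ENNReal.ofReal (1 / (1 + |z.1 - k|) ^ s₁)
  let V : (Fin d → ℤ) → ℝ≥0∞ := fun k => ENNReal.ofReal (1 / (1 + ‖z.2 - latt k‖) ^ s₂)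
  let a : ℤ → ℝ≥0∞ := fun k₁ => (∑' k₂ : Fin d → ℤ, ‖c k₁ k₂‖ₑ ^ q) ^ (1 / q)
  -- The decay weight is a product, so Hölder applies in k₂ with exponent q for fixed k₁, and then
  -- in k₁ with exponent p.
  have hinner : ∀ k₁, ∑' k₂ : Fin d → ℤ, ‖c k₁ k₂‖ₑ * V k₂ ≤ a k₁ * ENNReal.ofReal T₂ :=
    fun k₁ => (tsum_mul_le_Lp_mul_Lq hcq _ _).trans (mul_le_mul' le_rfl w2)
  have hnorm : (∑' k₁, a k₁ ^ p) ^ (1 / p) = seqNorm p q c := by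
    unfold seqNorm
    congr 1
    refine tsum_congr fun k₁ => ?_
    rw [← ENNReal.rpow_mul, one_div_mul_eq_div]
  calc _ ≤ ∑' k₁ : ℤ, ∑' k₂ : Fin d → ℤ, ENNReal.ofReal ct * (U k₁ * (‖c k₁ k₂‖ₑ * V k₂)) := by
        refine ENNReal.tsum_le_tsum fun k₁ => ENNReal.tsum_le_tsum fun k₂ => ?_
        refine (mul_le_mul' le_rfl (enorm_generator_le hφ i _ _)).trans (le_of_eq ?_)
        simp only [U, V]
        ring
    _ = ENNReal.ofReal ct * ∑' k₁ : ℤ, U k₁ * ∑' k₂ : Fin d → ℤ, ‖c k₁ k₂‖ₑ * V k₂ := by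
        simp_rw [ENNReal.tsum_mul_left]
    _ ≤ ENNReal.ofReal ct * ∑' k₁ : ℤ, U k₁ * (a k₁ * ENNReal.ofReal T₂) := by
        gcongr with k₁
        exact hinner k₁
    _ = ENNReal.ofReal ct * ((∑' k₁ : ℤ, a k₁ * U k₁) * ENNReal.ofReal T₂) := by
        rw [← ENNReal.tsum_mul_right]
        congr 1
        exact tsum_congr fun k₁ => by ring
    _ ≤ ENNReal.ofReal ct * ((seqNorm p q c * ENNReal.ofReal T₁) * ENNReal.ofReal T₂) := by
        gcongr
        refine (tsum_mul_le_Lp_mul_Lq hcp _ _).trans ?_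
        rw [hnorm]
        exact mul_le_mul' le_rfl w1
    _ = _ := by
        rw [embConst, ENNReal.ofReal_mul (by positivity), ENNReal.ofReal_mul hct.le]
        ring

/-- Pointwise bound for the functions generated by coefficients of finite norm. -/
lemma enorm_synth_le (hd : 1 ≤ d) (hp : 1 < p) (hq : 1 < q)
    (hφ : Generators p q α₁ α₂ ct s₁ s₂ φ) (c : Fin r → ℤ → (Fin d → ℤ) → ℂ) (z : Pt d) :
    ‖synth φ c z‖ₑ ≤ ENNReal.ofReal (embConst d p q ct s₁ s₂) * vecSeqNorm p q c := by
  calc ‖synth φ c z‖ₑ ≤ ∑' k₁ : ℤ, ∑' k₂ : Fin d → ℤ, ∑ i,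
        ‖c i k₁ k₂‖ₑ * ‖φ i (z.1 - (k₁ : ℝ), z.2 - latt k₂)‖ₑ := by
        refine enorm_tsum_le_tsum_enorm.trans (ENNReal.tsum_le_tsum fun k₁ => ?_)
        refine enorm_tsum_le_tsum_enorm.trans (ENNReal.tsum_le_tsum fun k₂ => ?_)
        refine (enorm_sum_le _ _).trans (le_of_eq ?_)
        simp_rw [enorm_mul]
    _ = ∑ i, ∑' k₁ : ℤ, ∑' k₂ : Fin d → ℤ,
        ‖c i k₁ k₂‖ₑ * ‖φ i (z.1 - (k₁ : ℝ), z.2 - latt k₂)‖ₑ := by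
        rw [← Summable.tsum_finsetSum fun i _ => ENNReal.summable]
        refine tsum_congr fun k₁ => ?_
        rw [← Summable.tsum_finsetSum fun i _ => ENNReal.summable]
    _ ≤ ∑ i, ENNReal.ofReal (embConst d p q ct s₁ s₂) * seqNorm p q (c i) :=
        Finset.sum_le_sum fun i _ => tsum_enorm_shift_le hd hp hq hφ i (c i) z
    _ = _ := by rw [vecSeqNorm, Finset.mul_sum]

/-- The functions in `V_N` have finite norm and are bounded. -/
lemma VN_bound (hd : 1 ≤ d) (hp : 1 < p) (hq : 1 < q)
    (hφ : Generators p q α₁ α₂ ct s₁ s₂ φ) {N : ℕ} {f : Pt d → ℂ} (hf : f ∈ VN N φ) :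
    mixedNorm p q f < ∞ ∧
      ∀ z, ‖f z‖ₑ ≤ ENNReal.ofReal (cStar d p q α₁ ct s₁ s₂) * mixedNorm p q f := by
  classical
  obtain ⟨c, hc⟩ := hf
  set A := Finset.Icc (-(N : ℤ)) N
  set B := Fintype.piFinset (fun _ : Fin d => Finset.Icc (-(N : ℤ)) N)
  -- Cutting the coefficients off outside the box does not change f and gives them finite norm, as
  -- the stability assumption requires.
  let c' : Fin r → ℤ → (Fin d → ℤ) → ℂ := fun i k₁ k₂ => if k₁ ∈ A ∧ k₂ ∈ B then c i k₁ k₂ else 0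
  have hfs : f = synth φ c' := by
    rw [hc]
    funext z
    have h1 : ∀ k₁ ∉ A, ∑' k₂ : Fin d → ℤ, ∑ i, c' i k₁ k₂ *
        φ i (z.1 - (k₁ : ℝ), z.2 - latt k₂) = 0 := fun k₁ hk => by simp [c', hk]
    have h2 : ∀ k₁, ∀ k₂ ∉ B, ∑ i, c' i k₁ k₂ *
        φ i (z.1 - (k₁ : ℝ), z.2 - latt k₂) = 0 := fun k₁ k₂ hk => by simp [c', hk]
    simp only [synth]
    rw [tsum_eq_sum h1, Finset.sum_comm]
    refine Finset.sum_congr rfl fun k₁ hk₁ => ?_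
    rw [tsum_eq_sum (h2 k₁), Finset.sum_comm]
    refine Finset.sum_congr rfl fun k₂ hk₂ => Finset.sum_congr rfl fun i _ => ?_
    simp [c', hk₁, hk₂]
  have hp0 : 0 < p := by linarith
  have hq0 : 0 < q := by linarith
  have hfin : vecSeqNorm p q c' < ∞ := by
    refine ENNReal.sum_lt_top.2 fun i _ => ENNReal.rpow_lt_top_of_nonneg (by positivity) ?_
    have h1 : ∀ k₁ ∉ A, (∑' k₂ : Fin d → ℤ, ‖c' i k₁ k₂‖ₑ ^ q) ^ (p / q) = 0 := fun k₁ hk => by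
      simp [c', hk, hq0, hp0]
    rw [tsum_eq_sum h1]
    refine ENNReal.sum_ne_top.2 fun k₁ _ => ENNReal.rpow_ne_top_of_nonneg (by positivity) ?_
    have h2 : ∀ k₂ ∉ B, ‖c' i k₁ k₂‖ₑ ^ q = 0 := fun k₂ hk => by simp [c', hk, hq0]
    rw [tsum_eq_sum h2]
    exact ENNReal.sum_ne_top.2 fun k₂ _ =>
      ENNReal.rpow_ne_top_of_nonneg hq0.le enorm_ne_top
  obtain ⟨hlow, hupp⟩ := hφ.stable c' hfin
  rw [← hfs] at hlow hupp
  refine ⟨hupp.trans_lt (ENNReal.mul_lt_top ENNReal.ofReal_lt_top hfin), fun z => ?_⟩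
  have hα := hφ.alpha_one_pos
  calc ‖f z‖ₑ ≤ ENNReal.ofReal (embConst d p q ct s₁ s₂) * vecSeqNorm p q c' := by
        rw [hfs]
        exact enorm_synth_le hd hp hq hφ c' z
    _ ≤ ENNReal.ofReal (α₁ * cStar d p q α₁ ct s₁ s₂) * vecSeqNorm p q c' := by
        gcongr
        exact embConst_le_cStar hd hp hq hφ
    _ = ENNReal.ofReal (cStar d p q α₁ ct s₁ s₂) * (ENNReal.ofReal α₁ * vecSeqNorm p q c') := by
        rw [ENNReal.ofReal_mul hα.le]
        ring
    _ ≤ _ := by gcongr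

end MixedSampling

/-! ### Mixed norms on the cuboid and convolution -/

namespace MixedSampling

variable {d : ℕ} {p q K₁ K₂ : ℝ}

instance isAddHaarMeasure_volume_pt (d : ℕ) : (volume : Measure (Pt d)).IsAddHaarMeasure :=
  Measure.prod.instIsAddHaarMeasure (volume : Measure ℝ)
    (volume : Measure (EuclideanSpace ℝ (Fin d)))

lemma measurableSet_cube (d : ℕ) (a : ℝ) : MeasurableSet (cube d a) := by
  have : cube d a = ⋂ i, {y : EuclideanSpace ℝ (Fin d) | |y i| ≤ a} := by
    ext y
    simp [cube]
  rw [this]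
  exact MeasurableSet.iInter fun i => (isClosed_le (by fun_prop) continuous_const).measurableSet

lemma measurableSet_cuboid (d : ℕ) (K₁ K₂ : ℝ) : MeasurableSet (cuboid d K₁ K₂) :=
  measurableSet_Icc.prod (measurableSet_cube d K₂)

lemma volume_cube (d : ℕ) {a : ℝ} (ha : 0 < a) :
    volume (cube d a) = ENNReal.ofReal ((2 * a) ^ (d : ℝ)) := by
  have h : cube d a = WithLp.ofLp ⁻¹' (Set.univ.pi fun _ : Fin d => Set.Icc (-a) a) := by
    ext y
    simp only [cube, Set.mem_preimage, Set.mem_univ_pi, Set.mem_Icc, Set.mem_ofPred_eq, abs_le]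
  rw [h, (PiLp.volume_preserving_ofLp (Fin d)).measure_preimage
    (MeasurableSet.univ_pi fun _ => measurableSet_Icc).nullMeasurableSet, volume_pi_pi]
  simp only [Real.volume_Icc, Finset.prod_const, Finset.card_univ, Fintype.card_fin]
  rw [← ENNReal.ofReal_pow (by linarith), Real.rpow_natCast]
  congr 2
  ring

lemma volume_side {a : ℝ} : volume (Set.Icc (-a) a) = ENNReal.ofReal (2 * a) := by
  rw [Real.volume_Icc]
  congr 1
  ring

lemma setLIntegral_cuboid (K₁ K₂ : ℝ) {h : Pt d → ℝ≥0∞} (hh : AEMeasurable h) :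
    ∫⁻ z in cuboid d K₁ K₂, h z = ∫⁻ x in Set.Icc (-K₁) K₁, ∫⁻ y in cube d K₂, h (x, y) := by
  have hm : (volume : Measure (Pt d)).restrict (cuboid d K₁ K₂) =
      (volume.restrict (Set.Icc (-K₁) K₁)).prod (volume.restrict (cube d K₂)) := by
    rw [Measure.prod_restrict]
    rfl
  rw [hm, lintegral_prod]
  rw [← hm]
  exact hh.restrict

/-- The `L¹` norm of an averaging function. -/
lemma lintegral_averaging {ψ : Pt d → ℂ} (hψ : Averaging K₁ K₂ ψ) :
    ∫⁻ z, ‖ψ z‖ₑ = ENNReal.ofReal (avgNorm K₁ K₂ ψ) := by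
  have h1 : mixedNormCuboid 1 1 K₁ K₂ ψ = ∫⁻ z, ‖ψ z‖ₑ := by
    unfold mixedNormCuboid mixedNormOn
    simp only [ENNReal.rpow_one, div_one]
    rw [← setLIntegral_cuboid K₁ K₂ (h := fun z => ‖ψ z‖ₑ) hψ.integrable.1.enorm,
      ← lintegral_indicator (measurableSet_cuboid d K₁ K₂)]
    refine lintegral_congr_ae (hψ.support.mono fun z hz => ?_)
    by_cases h : z ∈ cuboid d K₁ K₂
    · simp [h]
    · simp [h, hz h]
  rw [avgNorm, h1, ENNReal.ofReal_toReal hψ.integrable.2.ne]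

lemma integral_norm_averaging {ψ : Pt d → ℂ} (hψ : Averaging K₁ K₂ ψ) :
    ∫ z, ‖ψ z‖ = avgNorm K₁ K₂ ψ := by
  rw [integral_norm_eq_lintegral_enorm hψ.integrable.1, lintegral_averaging hψ,
    ENNReal.toReal_ofReal (show 0 ≤ avgNorm K₁ K₂ ψ from ENNReal.toReal_nonneg)]

lemma conv_apply (f ψ : Pt d → ℂ) (z : Pt d) : conv f ψ z = ∫ t, f t * ψ (z - t) := rfl

lemma integrable_conv_integrand {f ψ : Pt d → ℂ} (hf : Continuous f) {C : ℝ}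
    (hC : ∀ z, ‖f z‖ ≤ C) (hψ : Integrable ψ) (z : Pt d) :
    Integrable fun t => f t * ψ (z - t) :=
  (hψ.comp_sub_left z).bdd_mul hf.aestronglyMeasurable (Filter.Eventually.of_forall hC)

lemma norm_conv_le {f ψ : Pt d → ℂ} {C : ℝ} (hC : ∀ z, ‖f z‖ ≤ C) (hψ : Averaging K₁ K₂ ψ)
    (z : Pt d) : ‖conv f ψ z‖ ≤ C * avgNorm K₁ K₂ ψ := by
  rw [conv_apply, ← integral_norm_averaging hψ,
    ← integral_sub_left_eq_self (fun t => ‖ψ t‖) volume z, ← integral_const_mul]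
  refine norm_integral_le_of_norm_le ((hψ.integrable.comp_sub_left z).norm.const_mul C)
    (Filter.Eventually.of_forall fun t => ?_)
  rw [norm_mul]
  exact mul_le_mul_of_nonneg_right (hC t) (norm_nonneg _)

lemma continuous_conv {f ψ : Pt d → ℂ} (hf : Continuous f) {C : ℝ}
    (hC : ∀ z, ‖f z‖ ≤ C) (hψ : Integrable ψ) : Continuous (conv f ψ) := by
  unfold conv
  -- The order is exchanged so that ψ is the integrable factor and f the bounded continuous one.
  rw [← convolution_flip]
  refine BddAbove.continuous_convolution_right_of_integrable _ ⟨C, ?_⟩ hψ hf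
  rintro _ ⟨z, rfl⟩
  exact hC z

/-- Jensen's inequality for powers, in the form given by Hölder's inequality. -/
lemma lintegral_rpow_le {α : Type*} [MeasurableSpace α] (μ : Measure α) {s : ℝ} (hs : 1 < s)
    {u : α → ℝ≥0∞} (hu : AEMeasurable u μ) :
    (∫⁻ a, u a ∂μ) ^ s ≤ μ Set.univ ^ (s - 1) * ∫⁻ a, u a ^ s ∂μ := by
  have hs0 : 0 < s := by linarith
  have h := ENNReal.lintegral_mul_le_Lp_mul_Lq μ (Real.HolderConjugate.conjExponent hs) hu
    (g := fun _ => 1) aemeasurable_const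
  simp only [Pi.mul_apply, mul_one, ENNReal.one_rpow, lintegral_const, one_mul] at h
  calc (∫⁻ a, u a ∂μ) ^ s
      ≤ ((∫⁻ a, u a ^ s ∂μ) ^ (1 / s) * μ Set.univ ^ (1 / s.conjExponent)) ^ s := by gcongr
    _ = _ := by
      rw [ENNReal.mul_rpow_of_nonneg _ _ hs0.le, ← ENNReal.rpow_mul, ← ENNReal.rpow_mul,
        one_div_mul_cancel hs0.ne', ENNReal.rpow_one, mul_comm]
      congr 2
      rw [Real.conjExponent]
      field_simp

/-- The `L¹` norm on a cuboid is controlled by the mixed norm. -/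
lemma lintegral_cuboid_le_mixedNormOn (hp : 1 < p) (hq : 1 < q) (hK₁ : 0 < K₁) (hK₂ : 0 < K₂)
    {f : Pt d → ℂ} (hf : Continuous f) :
    ∫⁻ z in cuboid d K₁ K₂, ‖f z‖ₑ ≤
      ENNReal.ofReal ((2 * K₁) ^ ((p - 1) / p) * (2 * K₂) ^ ((d : ℝ) * ((q - 1) / q))) *
        mixedNormCuboid p q K₁ K₂ f := by
  have hp0 : 0 < p := by linarith
  have hq0 : 0 < q := by linarith
  have hp1 : 0 < p - 1 := by linarith
  have hq1 : 0 < q - 1 := by linarith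
  have hm : Measurable fun z => ‖f z‖ₑ := hf.enorm.measurable
  rw [setLIntegral_cuboid K₁ K₂ hm.aemeasurable]
  set V₁ := ENNReal.ofReal (2 * K₁) with hV₁
  set V₂ := ENNReal.ofReal ((2 * K₂) ^ (d : ℝ)) with hV₂
  have hinner : ∀ x, (∫⁻ y in cube d K₂, ‖f (x, y)‖ₑ) ^ p ≤
      V₂ ^ ((q - 1) * (p / q)) * (∫⁻ y in cube d K₂, ‖f (x, y)‖ₑ ^ q) ^ (p / q) := by
    intro x
    have h := lintegral_rpow_le (volume.restrict (cube d K₂)) hq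
      (u := fun y => ‖f (x, y)‖ₑ) (hm.comp measurable_prodMk_left).aemeasurable
    rw [Measure.restrict_apply_univ, volume_cube d hK₂] at h
    calc (∫⁻ y in cube d K₂, ‖f (x, y)‖ₑ) ^ p
        = ((∫⁻ y in cube d K₂, ‖f (x, y)‖ₑ) ^ q) ^ (p / q) := by
          rw [← ENNReal.rpow_mul, mul_div_cancel₀ _ hq0.ne']
      _ ≤ _ := ENNReal.rpow_le_rpow h (by positivity)
      _ = _ := by rw [ENNReal.mul_rpow_of_nonneg _ _ (by positivity), ← ENNReal.rpow_mul]
  have houter := lintegral_rpow_le (volume.restrict (Set.Icc (-K₁) K₁)) hp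
      (u := fun x => ∫⁻ y in cube d K₂, ‖f (x, y)‖ₑ) hm.lintegral_prod_right'.aemeasurable
  rw [Measure.restrict_apply_univ, volume_side] at houter
  have hmain : (∫⁻ x in Set.Icc (-K₁) K₁, ∫⁻ y in cube d K₂, ‖f (x, y)‖ₑ) ^ p ≤
      V₁ ^ (p - 1) * (V₂ ^ ((q - 1) * (p / q)) * ∫⁻ x in Set.Icc (-K₁) K₁,
        (∫⁻ y in cube d K₂, ‖f (x, y)‖ₑ ^ q) ^ (p / q)) := by
    refine houter.trans (mul_le_mul' le_rfl ?_)
    rw [← lintegral_const_mul']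
    · exact lintegral_mono hinner
    · exact ENNReal.rpow_ne_top_of_nonneg (by positivity) ENNReal.ofReal_ne_top
  have := ENNReal.rpow_le_rpow hmain (one_div_nonneg.2 hp0.le)
  rw [← ENNReal.rpow_mul, mul_one_div_cancel hp0.ne', ENNReal.rpow_one] at this
  refine this.trans (le_of_eq ?_)
  rw [ENNReal.mul_rpow_of_nonneg _ _ (by positivity),
    ENNReal.mul_rpow_of_nonneg _ _ (by positivity),
    ← ENNReal.rpow_mul, ← ENNReal.rpow_mul, ENNReal.ofReal_mul (by positivity), Real.rpow_mul
    (by positivity), ← ENNReal.ofReal_rpow_of_nonneg (by positivity) (by positivity),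
    ← ENNReal.ofReal_rpow_of_nonneg (by positivity) (by positivity), mul_assoc]
  have e1 : (p - 1) * (1 / p) = (p - 1) / p := by ring
  have e2 : (q - 1) * (p / q * (1 / p)) = (q - 1) / q := by field_simp
  rw [e1, e2, ← mul_assoc]
  rfl

/-- The mixed norm on a cuboid is controlled by the `L^{pq}` norm. -/
lemma mixedNormCuboid_rpow_le (hp : 1 < p) (hq : 1 < q) (hK₁ : 0 < K₁) (hK₂ : 0 < K₂)
    {f : Pt d → ℂ} (hf : Continuous f) :
    mixedNormCuboid p q K₁ K₂ f ^ (p * q) ≤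
      ENNReal.ofReal (boxFactor d p q K₁ K₂) * ∫⁻ z in cuboid d K₁ K₂, ‖f z‖ₑ ^ (p * q) := by
  have hp0 : 0 < p := by linarith
  have hq0 : 0 < q := by linarith
  have hp1 : 0 < p - 1 := by linarith
  have hq1 : 0 < q - 1 := by linarith
  have hm : Measurable fun z => ‖f z‖ₑ := hf.enorm.measurable
  rw [setLIntegral_cuboid K₁ K₂ (hm.pow_const _).aemeasurable]
  set V₁ := ENNReal.ofReal (2 * K₁) with hV₁
  set V₂ := ENNReal.ofReal ((2 * K₂) ^ (d : ℝ)) with hV₂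
  -- In the power pq, the outer integral carries an exponent q and the inner one an exponent p.
  -- Jensen therefore yields crossed exponents: q-1 on the side 2K₁ and p-1 on the cube, which is
  -- the factor D.
  have hinner : ∀ x, ((∫⁻ y in cube d K₂, ‖f (x, y)‖ₑ ^ q) ^ (p / q)) ^ q ≤
      V₂ ^ (p - 1) * ∫⁻ y in cube d K₂, ‖f (x, y)‖ₑ ^ (p * q) := by
    intro x
    have h := lintegral_rpow_le (volume.restrict (cube d K₂)) hp
      (u := fun y => ‖f (x, y)‖ₑ ^ q)
      ((hm.pow_const q).comp measurable_prodMk_left).aemeasurable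
    rw [Measure.restrict_apply_univ, volume_cube d hK₂] at h
    simp_rw [← ENNReal.rpow_mul] at h ⊢
    rwa [div_mul_cancel₀ _ hq0.ne', mul_comm p q]
  have houter := lintegral_rpow_le (volume.restrict (Set.Icc (-K₁) K₁)) hq
      (u := fun x => (∫⁻ y in cube d K₂, ‖f (x, y)‖ₑ ^ q) ^ (p / q))
      ((hm.pow_const q).lintegral_prod_right'.pow_const _).aemeasurable
  rw [Measure.restrict_apply_univ, volume_side] at houter
  have hbox : ENNReal.ofReal (boxFactor d p q K₁ K₂) = V₁ ^ (q - 1) * V₂ ^ (p - 1) := by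
    rw [boxFactor, ENNReal.ofReal_mul (by positivity), Real.rpow_mul (by positivity),
      ← ENNReal.ofReal_rpow_of_nonneg (by positivity) (by positivity),
      ← ENNReal.ofReal_rpow_of_nonneg (by positivity) (by positivity)]
  calc mixedNormCuboid p q K₁ K₂ f ^ (p * q)
      = (∫⁻ x in Set.Icc (-K₁) K₁, (∫⁻ y in cube d K₂, ‖f (x, y)‖ₑ ^ q) ^ (p / q)) ^ q := by
        rw [mixedNormCuboid, mixedNormOn, ← ENNReal.rpow_mul]
        congr 1
        field_simp
    _ ≤ _ := houter
    _ ≤ V₁ ^ (q - 1) * (V₂ ^ (p - 1) * ∫⁻ x in Set.Icc (-K₁) K₁,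
          ∫⁻ y in cube d K₂, ‖f (x, y)‖ₑ ^ (p * q)) := by
        refine mul_le_mul' le_rfl ?_
        rw [← lintegral_const_mul']
        · exact lintegral_mono hinner
        · exact ENNReal.rpow_ne_top_of_nonneg (by positivity) ENNReal.ofReal_ne_top
    _ = _ := by rw [hbox, mul_assoc]

/-- The mixed norm on a cuboid of a translate is at most the full mixed norm. -/
lemma mixedNormCuboid_translate_le (hp : 0 < p) (hq : 0 < q) (f : Pt d → ℂ) (u : Pt d) :
    mixedNormCuboid p q K₁ K₂ (fun z => f (z - u)) ≤ mixedNorm p q f := by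
  unfold mixedNormCuboid mixedNorm mixedNormOn
  refine ENNReal.rpow_le_rpow ?_ (by positivity)
  simp only [Measure.restrict_univ]
  refine (setLIntegral_le_lintegral _ _).trans ?_
  rw [← lintegral_sub_right_eq_self (μ := volume)
    (fun x => (∫⁻ y, ‖f (x, y)‖ₑ ^ q) ^ (p / q)) u.1]
  refine lintegral_mono fun x => ENNReal.rpow_le_rpow ?_ (by positivity)
  refine (setLIntegral_le_lintegral _ _).trans (le_of_eq ?_)
  rw [← lintegral_sub_right_eq_self (μ := volume) (fun y => ‖f (x - u.1, y)‖ₑ ^ q) u.2]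
  rfl

/-- The `L¹` norm of `f * ψ` on the cuboid. -/
lemma lintegral_cuboid_conv_le (hp : 1 < p) (hq : 1 < q) (hK₁ : 0 < K₁) (hK₂ : 0 < K₂)
    {f ψ : Pt d → ℂ} (hf : Continuous f) (hψ : Averaging K₁ K₂ ψ) :
    ∫⁻ z in cuboid d K₁ K₂, ‖conv f ψ z‖ₑ ≤
      ENNReal.ofReal ((2 * K₁) ^ ((p - 1) / p) * (2 * K₂) ^ ((d : ℝ) * ((q - 1) / q)) *
        avgNorm K₁ K₂ ψ) * mixedNorm p q f := by
  -- With u = z - t the integrand contains a translate of f. After Fubini each translate is bounded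
  -- on the cuboid by Hölder, uniformly in u, and the integral over u contributes only ‖ψ‖.
  have hpt : ∀ z, ‖conv f ψ z‖ₑ ≤ ∫⁻ u, ‖ψ u‖ₑ * ‖f (z - u)‖ₑ := by
    intro z
    rw [conv_apply, ← lintegral_sub_left_eq_self _ z]
    refine (enorm_integral_le_lintegral_enorm _).trans (le_of_eq ?_)
    refine lintegral_congr fun t => ?_
    rw [enorm_mul, mul_comm, sub_sub_cancel]
  calc ∫⁻ z in cuboid d K₁ K₂, ‖conv f ψ z‖ₑ
      ≤ ∫⁻ z in cuboid d K₁ K₂, ∫⁻ u, ‖ψ u‖ₑ * ‖f (z - u)‖ₑ := lintegral_mono hpt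
    _ = ∫⁻ u, ∫⁻ z in cuboid d K₁ K₂, ‖ψ u‖ₑ * ‖f (z - u)‖ₑ := by
        refine lintegral_lintegral_swap ?_
        have h1 : AEMeasurable (fun w : Pt d × Pt d => ‖ψ w.2‖ₑ)
            ((volume.restrict (cuboid d K₁ K₂)).prod volume) := hψ.integrable.1.enorm.comp_snd
        have h2 : AEMeasurable (fun w : Pt d × Pt d => ‖f (w.1 - w.2)‖ₑ)
            ((volume.restrict (cuboid d K₁ K₂)).prod volume) :=
          (hf.comp (continuous_fst.sub continuous_snd)).enorm.measurable.aemeasurable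
        exact h1.mul h2
    _ ≤ ∫⁻ u, ‖ψ u‖ₑ * (ENNReal.ofReal ((2 * K₁) ^ ((p - 1) / p) *
          (2 * K₂) ^ ((d : ℝ) * ((q - 1) / q))) * mixedNorm p q f) := by
        refine lintegral_mono fun u => ?_
        rw [lintegral_const_mul' _ _ enorm_ne_top]
        refine mul_le_mul' le_rfl ?_
        refine (lintegral_cuboid_le_mixedNormOn hp hq hK₁ hK₂
          (hf.comp (continuous_id.sub continuous_const))).trans ?_
        exact mul_le_mul' le_rfl (mixedNormCuboid_translate_le (by linarith) (by linarith) f u)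
    _ = _ := by
        rw [lintegral_mul_const'' _ hψ.integrable.1.enorm, lintegral_averaging hψ,
          ENNReal.ofReal_mul (q := avgNorm K₁ K₂ ψ) (by positivity)]
        ring

end MixedSampling

/-! ### Sampling law, finite arrays and deviation over V_N -/

namespace MixedSampling

variable {d r : ℕ} {p q K₁ K₂ α₁ α₂ ct s₁ s₂ c₁ c₂ : ℝ}

lemma lintegral_law {ρ : Pt d → ℝ} (hρ : Density K₁ K₂ c₁ c₂ ρ) {h : Pt d → ℝ≥0∞}
    (hh : Measurable h) :
    ∫⁻ z, h z ∂law K₁ K₂ ρ = ∫⁻ z in cuboid d K₁ K₂, ENNReal.ofReal (ρ z) * h z := by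
  rw [law, lintegral_withDensity_eq_lintegral_mul₀ hρ.aemeasurable.ennreal_ofReal hh.aemeasurable]
  rfl

lemma le_lintegral_law {ρ : Pt d → ℝ} (hρ : Density K₁ K₂ c₁ c₂ ρ) {h : Pt d → ℝ≥0∞}
    (hh : Measurable h) :
    ENNReal.ofReal c₁ * ∫⁻ z in cuboid d K₁ K₂, h z ≤ ∫⁻ z, h z ∂law K₁ K₂ ρ := by
  rw [lintegral_law hρ hh, ← lintegral_const_mul' _ _ ENNReal.ofReal_ne_top]
  exact setLIntegral_mono' (measurableSet_cuboid d K₁ K₂) fun z hz =>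
    mul_le_mul' (ENNReal.ofReal_le_ofReal (hρ.bounds z hz).1) le_rfl

lemma lintegral_law_le {ρ : Pt d → ℝ} (hρ : Density K₁ K₂ c₁ c₂ ρ) {h : Pt d → ℝ≥0∞}
    (hh : Measurable h) :
    ∫⁻ z, h z ∂law K₁ K₂ ρ ≤ ENNReal.ofReal c₂ * ∫⁻ z in cuboid d K₁ K₂, h z := by
  rw [lintegral_law hρ hh, ← lintegral_const_mul' _ _ ENNReal.ofReal_ne_top]
  exact setLIntegral_mono' (measurableSet_cuboid d K₁ K₂) fun z hz =>
    mul_le_mul' (ENNReal.ofReal_le_ofReal (hρ.bounds z hz).2) le_rfl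

lemma finset_sum_rpow_le {κ : Type*} (s : Finset κ) (b : κ → ℝ≥0∞) {q : ℝ} (hq : 1 ≤ q) :
    ∑ k ∈ s, b k ^ q ≤ (∑ k ∈ s, b k) ^ q := by
  classical
  induction s using Finset.induction_on with
  | empty => simp [show 0 < q by linarith]
  | insert a s ha ih =>
    rw [Finset.sum_insert ha, Finset.sum_insert ha]
    exact (add_le_add le_rfl ih).trans (ENNReal.add_rpow_le_rpow_add _ _ hq)

lemma sampleNorm_le_sum (hp : 1 < p) (hq : 1 < q) (n m : ℕ) (a : ℕ → ℕ → ℂ) :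
    sampleNorm p q n m a ≤ ∑ j ∈ Finset.Icc 1 n, ∑ k ∈ Finset.Icc 1 m, ‖a j k‖ₑ := by
  have hp0 : 0 < p := by linarith
  have hq0 : 0 < q := by linarith
  rw [sampleNorm, one_div, ENNReal.rpow_inv_le_iff hp0]
  refine le_trans (Finset.sum_le_sum fun j _ => ?_) (finset_sum_rpow_le _ _ hp.le)
  calc _ ≤ ((∑ k ∈ Finset.Icc 1 m, ‖a j k‖ₑ) ^ q) ^ (p / q) :=
        ENNReal.rpow_le_rpow (finset_sum_rpow_le _ _ hq.le) (by positivity)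
    _ = _ := by rw [← ENNReal.rpow_mul, mul_div_cancel₀ _ hq0.ne']

/-- Hölder in k, then in j. Dividing nm by this constant is what leaves n^{1/p}m^{1/q} in the lower
sampling constant. -/
lemma sum_le_sampleNorm (hp : 1 < p) (hq : 1 < q) (n m : ℕ) (a : ℕ → ℕ → ℂ) :
    ∑ j ∈ Finset.Icc 1 n, ∑ k ∈ Finset.Icc 1 m, ‖a j k‖ₑ ≤
      ENNReal.ofReal ((n : ℝ) ^ ((p - 1) / p) * (m : ℝ) ^ ((q - 1) / q)) *
        sampleNorm p q n m a := by
  have hp0 : 0 < p := by linarith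
  have hq0 : 0 < q := by linarith
  have hp1 : 0 < p - 1 := by linarith
  have hq1 : 0 < q - 1 := by linarith
  have hinner : ∀ j, (∑ k ∈ Finset.Icc 1 m, ‖a j k‖ₑ) ^ p ≤
      (m : ℝ≥0∞) ^ ((q - 1) * (p / q)) * (∑ k ∈ Finset.Icc 1 m, ‖a j k‖ₑ ^ q) ^ (p / q) := by
    intro j
    have h := ENNReal.rpow_sum_le_const_mul_sum_rpow (Finset.Icc 1 m) (fun k => ‖a j k‖ₑ) hq.le
    rw [Nat.card_Icc, Nat.add_sub_cancel] at h
    calc (∑ k ∈ Finset.Icc 1 m, ‖a j k‖ₑ) ^ p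
        = ((∑ k ∈ Finset.Icc 1 m, ‖a j k‖ₑ) ^ q) ^ (p / q) := by
          rw [← ENNReal.rpow_mul, mul_div_cancel₀ _ hq0.ne']
      _ ≤ _ := ENNReal.rpow_le_rpow h (by positivity)
      _ = _ := by rw [ENNReal.mul_rpow_of_nonneg _ _ (by positivity), ← ENNReal.rpow_mul]
  have houter := ENNReal.rpow_sum_le_const_mul_sum_rpow (Finset.Icc 1 n)
    (fun j => ∑ k ∈ Finset.Icc 1 m, ‖a j k‖ₑ) hp.le
  rw [Nat.card_Icc, Nat.add_sub_cancel] at houter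
  have hmain : (∑ j ∈ Finset.Icc 1 n, ∑ k ∈ Finset.Icc 1 m, ‖a j k‖ₑ) ^ p ≤
      (n : ℝ≥0∞) ^ (p - 1) * ((m : ℝ≥0∞) ^ ((q - 1) * (p / q)) *
        ∑ j ∈ Finset.Icc 1 n, (∑ k ∈ Finset.Icc 1 m, ‖a j k‖ₑ ^ q) ^ (p / q)) := by
    refine houter.trans (mul_le_mul' le_rfl ?_)
    rw [Finset.mul_sum]
    exact Finset.sum_le_sum fun j _ => hinner j
  have := ENNReal.rpow_le_rpow hmain (one_div_nonneg.2 hp0.le)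
  rw [← ENNReal.rpow_mul, mul_one_div_cancel hp0.ne', ENNReal.rpow_one] at this
  refine this.trans (le_of_eq ?_)
  rw [ENNReal.mul_rpow_of_nonneg _ _ (by positivity),
    ENNReal.mul_rpow_of_nonneg _ _ (by positivity),
    ← ENNReal.rpow_mul, ← ENNReal.rpow_mul, ENNReal.ofReal_mul (by positivity),
    ← ENNReal.ofReal_rpow_of_nonneg (by positivity) (by positivity),
    ← ENNReal.ofReal_rpow_of_nonneg (by positivity) (by positivity), ENNReal.ofReal_natCast,
    ENNReal.ofReal_natCast]
  have e1 : (p - 1) * (1 / p) = (p - 1) / p := by ring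
  have e2 : (q - 1) * (p / q) * (1 / p) = (q - 1) / q := by field_simp
  rw [e1, e2, sampleNorm, mul_assoc]

section Space

variable {φ : Fin r → Pt d → ℂ}

open BoundedContinuousFunction

/-- The index set of the shifts that generate `V_N`. -/
abbrev ShiftIndex (d r N : ℕ) : Type :=
  Fin r × (Finset.Icc (-(N : ℤ)) N) × (Fin d → (Finset.Icc (-(N : ℤ)) N))

lemma norm_generator_le (hφ : Generators p q α₁ α₂ ct s₁ s₂ φ) (i : Fin r) (z : Pt d) :
    ‖φ i z‖ ≤ ct := by
  have h1 := hφ.s_one_pos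
  have h2 := hφ.s_two_pos
  refine (hφ.decay i z.1 z.2).trans (div_le_self hφ.ct_pos.le ?_)
  exact one_le_mul_of_one_le_of_one_le
    (Real.one_le_rpow (by linarith [abs_nonneg z.1]) h1.le)
    (Real.one_le_rpow (by linarith [norm_nonneg z.2]) h2.le)

/-- The shifts of the generators as bounded continuous functions. -/
noncomputable def shift (hφ : Generators p q α₁ α₂ ct s₁ s₂ φ) (N : ℕ)
    (a : ShiftIndex d r N) : Pt d →ᵇ ℂ :=
  BoundedContinuousFunction.ofNormedAddCommGroup
    (fun z => φ a.1 (z.1 - ((a.2.1 : ℤ) : ℝ), z.2 - latt fun l => ((a.2.2 l : ℤ))))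
    ((hφ.continuous a.1).comp (by fun_prop)) ct fun _ => norm_generator_le hφ _ _

/-- The space `V_N` inside the bounded continuous functions. -/
noncomputable def shiftSpan (hφ : Generators p q α₁ α₂ ct s₁ s₂ φ) (N : ℕ) :
    Submodule ℂ (Pt d →ᵇ ℂ) :=
  Submodule.span ℂ (Set.range (shift hφ N))

lemma card_shiftIndex (d r N : ℕ) :
    Fintype.card (ShiftIndex d r N) = r * (2 * N + 1) ^ (d + 1) := by
  have : ((N : ℤ) + 1 - -(N : ℤ)).toNat = 2 * N + 1 := by omega
  simp only [ShiftIndex, Fintype.card_prod, Fintype.card_fin, Fintype.card_coe, Int.card_Icc,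
    Fintype.card_pi, Finset.prod_const, Finset.card_univ, this]
  ring

instance (hφ : Generators p q α₁ α₂ ct s₁ s₂ φ) (N : ℕ) :
    FiniteDimensional ℂ (shiftSpan hφ N) :=
  FiniteDimensional.span_of_finite ℂ (Set.finite_range _)

/-- The factor 2 arises because the volume argument for nets works over ℝ while the coefficients are
complex. The shifts need not be independent here: only an upper bound matters. -/
lemma finrank_shiftSpan_le (hφ : Generators p q α₁ α₂ ct s₁ s₂ φ) (N : ℕ) :
    Module.finrank ℝ (shiftSpan hφ N) ≤ 2 * (r * (2 * N + 1) ^ (d + 1)) := by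
  rw [finrank_real_of_complex, ← card_shiftIndex]
  exact Nat.mul_le_mul le_rfl (finrank_range_le_card (R := ℂ) (shift hφ N))

lemma exists_mem_shiftSpan (hφ : Generators p q α₁ α₂ ct s₁ s₂ φ) {N : ℕ} {f : Pt d → ℂ}
    (hf : f ∈ VN N φ) : ∃ v : shiftSpan hφ N, ∀ z, v.1 z = f z := by
  obtain ⟨c, rfl⟩ := hf
  have hsh : ∀ (i : Fin r), ∀ k₁ ∈ Finset.Icc (-(N : ℤ)) N,
      ∀ k₂ ∈ Fintype.piFinset (fun _ : Fin d => Finset.Icc (-(N : ℤ)) N),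
      ∃ v ∈ shiftSpan hφ N, ∀ z : Pt d, v z = φ i (z.1 - (k₁ : ℝ), z.2 - latt k₂) := by
    intro i k₁ h₁ k₂ h₂
    exact ⟨_, Submodule.subset_span
      ⟨(i, ⟨k₁, h₁⟩, fun l => ⟨k₂ l, Fintype.mem_piFinset.1 h₂ l⟩), rfl⟩, fun z => rfl⟩
  choose! b hb hbz using hsh
  refine ⟨⟨∑ i, ∑ k₁ ∈ Finset.Icc (-(N : ℤ)) N,
      ∑ k₂ ∈ Fintype.piFinset (fun _ : Fin d => Finset.Icc (-(N : ℤ)) N),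
        c i k₁ k₂ • b i k₁ k₂, ?_⟩, fun z => ?_⟩
  · exact Submodule.sum_mem _ fun i _ => Submodule.sum_mem _ fun k₁ h₁ =>
      Submodule.sum_mem _ fun k₂ h₂ => Submodule.smul_mem _ _ (hb i k₁ h₁ k₂ h₂)
  · simp only [BoundedContinuousFunction.coe_sum, Finset.sum_apply]
    refine Finset.sum_congr rfl fun i _ => Finset.sum_congr rfl fun k₁ h₁ =>
      Finset.sum_congr rfl fun k₂ h₂ => ?_
    change c i k₁ k₂ • b i k₁ k₂ z = _
    rw [hbz i k₁ h₁ k₂ h₂, smul_eq_mul]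

end Space

/-- Uniform deviation of the sample means of `|f * ψ|` over `V_N`. -/
lemma sample_deviation {φ : Fin r → Pt d → ℂ} (hd : 1 ≤ d) (hr : 1 ≤ r) (hp : 1 < p) (hq : 1 < q)
    (hφ : Generators p q α₁ α₂ ct s₁ s₂ φ) {ψ : Pt d → ℂ} (hψ : Averaging K₁ K₂ ψ)
    (hpos : 0 < avgNorm K₁ K₂ ψ)
    {Ω ι : Type*} [MeasurableSpace Ω] (P : Measure Ω) [IsProbabilityMeasure P]
    {Z : ι → Ω → Pt d} (hZ : ∀ a, Measurable (Z a)) (hindep : iIndepFun Z P) {κ : Measure (Pt d)}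
    (hlaw : ∀ a, P.map (Z a) = κ) (s : Finset ι) (N : ℕ) {t : ℝ} (ht : 0 < t)
    (hx : 24 * (r * (2 * N + 1) ^ (d + 1) : ℝ) ≤ s.card * t ^ 2) :
    ∃ B : Set Ω, MeasurableSet B ∧
      P B ≤ ENNReal.ofReal (2 * Real.exp (-(s.card * t ^ 2 / 8))) ∧
      ∀ w ∉ B, ∀ f ∈ VN N φ,
        |∑ i ∈ s, ‖conv f ψ (Z i w)‖ - s.card * ∫ z, ‖conv f ψ z‖ ∂κ| ≤
          s.card * (t * (cStar d p q α₁ ct s₁ s₂ * avgNorm K₁ K₂ ψ) * (mixedNorm p q f).toReal) := by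
  set cs := cStar d p q α₁ ct s₁ s₂
  set nψ := avgNorm K₁ K₂ ψ with hnψ
  have hcs : 0 < cs := cStar_pos hd hp hq hφ
  -- Division by ‖ψ‖ makes F bounded by the sup norm of v and 1-Lipschitz in it, exactly as the
  -- chaining bound requires.
  let F : shiftSpan hφ N → Pt d → ℝ := fun v z => ‖conv v.1 ψ z‖ / nψ
  have hcont : ∀ v : shiftSpan hφ N, Continuous (conv v.1 ψ) := fun v =>
    continuous_conv v.1.continuous v.1.norm_coe_le_norm hψ.integrable
  have hle : ∀ v z, F v z ≤ ‖v‖ := fun v z => by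
    simp only [F]
    rw [div_le_iff₀ hpos]
    exact norm_conv_le v.1.norm_coe_le_norm hψ z
  have hlip : ∀ v w z, |F v z - F w z| ≤ ‖v - w‖ := fun v w z => by
    refine le_trans ?_ (hle (v - w) z)
    simp only [F]
    rw [← sub_div, abs_div, abs_of_pos hpos]
    refine div_le_div_of_nonneg_right ((abs_norm_sub_norm_le _ _).trans (le_of_eq ?_)) hpos.le
    rw [conv_apply, conv_apply, conv_apply, ← integral_sub
      (integrable_conv_integrand v.1.continuous v.1.norm_coe_le_norm hψ.integrable z)
      (integrable_conv_integrand w.1.continuous w.1.norm_coe_le_norm hψ.integrable z)]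
    congr 2
    funext t
    simp [sub_mul]
  have hM : 1 ≤ r * (2 * N + 1) ^ (d + 1) := Nat.mul_pos hr (by positivity)
  obtain ⟨B, hBm, hB, hdev⟩ := uniform_deviation P hZ hindep hlaw s hM
    (finrank_shiftSpan_le hφ N) (F := F)
    (fun v => ((hcont v).norm.div_const nψ).measurable)
    (fun v z => by positivity) hle hlip ht (by exact_mod_cast hx)
  refine ⟨B, hBm, hB, fun w hw f hf => ?_⟩
  obtain ⟨hfin, hbound⟩ := VN_bound hd hp hq hφ hf
  set A := (mixedNorm p q f).toReal with hA
  have hA0 : 0 ≤ A := ENNReal.toReal_nonneg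
  have hb : ∀ z, ‖f z‖ ≤ cs * A := fun z => by
    have h := hbound z
    rw [← ENNReal.ofReal_toReal hfin.ne, ← ENNReal.ofReal_mul hcs.le, ← ofReal_norm] at h
    exact (ENNReal.ofReal_le_ofReal_iff (by positivity)).1 h
  rcases hA0.eq_or_lt with h0 | hApos
  · have hz : ∀ z, conv f ψ z = 0 := fun z => by
      have := norm_conv_le hb hψ z
      rw [← h0, mul_zero, zero_mul] at this
      simpa using this
    simp [hz, ← h0]
  · obtain ⟨v, hv⟩ := exists_mem_shiftSpan hφ hf
    have hcA : 0 < cs * A := by positivity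
    -- The sup bound on V_N puts f/(c*A) in the unit ball, and |f*ψ| is homogeneous in f; scaling
    -- back produces the factor c*‖ψ‖A.
    let u : shiftSpan hφ N := (((cs * A)⁻¹ : ℝ) : ℂ) • v
    have huz : ∀ z, u.1 z = (((cs * A)⁻¹ : ℝ) : ℂ) * f z := fun z => by
      simp only [u, Submodule.coe_smul, BoundedContinuousFunction.coe_smul, smul_eq_mul, hv]
    have hu1 : ‖u‖ ≤ 1 := by
      refine (BoundedContinuousFunction.norm_le zero_le_one).2 fun z => ?_
      change ‖u.1 z‖ ≤ 1
      rw [huz, norm_mul, Complex.norm_real, Real.norm_of_nonneg (by positivity),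
        inv_mul_le_iff₀ hcA, mul_one]
      exact hb z
    have hFu : ∀ z, F u z = ‖conv f ψ z‖ / (cs * A * nψ) := fun z => by
      have : conv u.1 ψ z = (((cs * A)⁻¹ : ℝ) : ℂ) * conv f ψ z := by
        rw [conv_apply, conv_apply, ← integral_const_mul]
        congr 1
        funext t
        rw [huz, mul_assoc]
      simp only [F]
      rw [this, norm_mul, Complex.norm_real, Real.norm_of_nonneg (by positivity)]
      field_simp
    have h := hdev w hw u hu1
    have hL : 0 < cs * A * nψ := by positivity
    simp_rw [hFu] at h
    rw [integral_div, ← Finset.sum_div, ← mul_div_assoc, ← sub_div, abs_div, abs_of_pos hL,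
      div_le_iff₀ hL] at h
    refine h.trans (le_of_eq ?_)
    ring

end MixedSampling

/-! ### Mean bounds and numerical constants -/

namespace MixedSampling

variable {d r : ℕ} {p q K₁ K₂ α₁ α₂ ct s₁ s₂ c₁ c₂ : ℝ}

lemma boxFactor_pos (hK₁ : 0 < K₁) (hK₂ : 0 < K₂) : 0 < boxFactor d p q K₁ K₂ := by
  unfold boxFactor
  positivity

/-- The mean of `|f * ψ|` under the sampling law, from below and above. -/
lemma mean_bounds {φ : Fin r → Pt d → ℂ} (hd : 1 ≤ d) (hp : 1 < p) (hq : 1 < q)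
    (hK₁ : 0 < K₁) (hK₂ : 0 < K₂) (hφ : Generators p q α₁ α₂ ct s₁ s₂ φ) {ψ : Pt d → ℂ}
    (hψ : Averaging K₁ K₂ ψ) (hpos : 0 < avgNorm K₁ K₂ ψ) {ρ : Pt d → ℝ}
    (hρ : Density K₁ K₂ c₁ c₂ ρ) {N : ℕ} {ω : ℝ} (hω : 0 < ω) {f : Pt d → ℂ}
    (hf : f ∈ VNomega p q K₁ K₂ N ω ψ φ) :
    level d p q K₁ K₂ c₁ (cStar d p q α₁ ct s₁ s₂) (avgNorm K₁ K₂ ψ) ω *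
        (mixedNorm p q f).toReal ≤ ∫ z, ‖conv f ψ z‖ ∂law K₁ K₂ ρ ∧
      ∫ z, ‖conv f ψ z‖ ∂law K₁ K₂ ρ ≤
        c₂ * ((2 * K₁) ^ ((p - 1) / p) * (2 * K₂) ^ ((d : ℝ) * ((q - 1) / q)) *
          avgNorm K₁ K₂ ψ) * (mixedNorm p q f).toReal := by
  set cs := cStar d p q α₁ ct s₁ s₂ with hcs_def
  set nψ := avgNorm K₁ K₂ ψ with hnψ
  have hp0 : 0 < p := by linarith
  have hq0 : 0 < q := by linarith
  have hcs : 0 < cs := cStar_pos hd hp hq hφ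
  have hD : 0 < boxFactor d p q K₁ K₂ := boxFactor_pos hK₁ hK₂
  have hc₁ := hρ.c_one_pos
  have hc₂ := hρ.c_two_pos
  obtain ⟨hfN, hfω⟩ := hf
  obtain ⟨hfin, hbound⟩ := VN_bound hd hp hq hφ hfN
  have hfcont : Continuous f := by
    obtain ⟨v, hv⟩ := exists_mem_shiftSpan hφ hfN
    rw [← funext hv]
    exact v.1.continuous
  set A := (mixedNorm p q f).toReal with hA
  have hAeq : mixedNorm p q f = ENNReal.ofReal A := (ENNReal.ofReal_toReal hfin.ne).symm
  have hA0 : 0 ≤ A := ENNReal.toReal_nonneg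
  have hb : ∀ z, ‖f z‖ ≤ cs * A := fun z => by
    have h := hbound z
    rw [hAeq, ← ENNReal.ofReal_mul hcs.le, ← ofReal_norm] at h
    exact (ENNReal.ofReal_le_ofReal_iff (by positivity)).1 h
  have hg : Continuous (conv f ψ) := continuous_conv hfcont hb hψ.integrable
  have hgb : ∀ z, ‖conv f ψ z‖ ≤ cs * A * nψ := norm_conv_le hb hψ
  have hgm : Measurable fun z => ‖conv f ψ z‖ₑ := hg.enorm.measurable
  have hup := (lintegral_law_le hρ hgm).trans
    (mul_le_mul' le_rfl (lintegral_cuboid_conv_le hp hq hK₁ hK₂ hfcont hψ))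
  have hlow := le_lintegral_law hρ hgm
  set W := (2 * K₁) ^ ((p - 1) / p) * (2 * K₂) ^ ((d : ℝ) * ((q - 1) / q)) with hW
  have hW0 : 0 < W := by positivity
  rw [hAeq, ← ENNReal.ofReal_mul (by positivity), ← ENNReal.ofReal_mul (by positivity),
    ← mul_assoc c₂] at hup
  rw [integral_norm_eq_lintegral_enorm hg.aestronglyMeasurable]
  refine ⟨?_, ENNReal.toReal_le_of_le_ofReal (by positivity) hup⟩
  have hltop : ∫⁻ z, ‖conv f ψ z‖ₑ ∂law K₁ K₂ ρ ≠ ∞ :=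
    ne_top_of_le_ne_top ENNReal.ofReal_ne_top hup
  have hGtop : ∫⁻ z in cuboid d K₁ K₂, ‖conv f ψ z‖ₑ ≠ ∞ := by
    refine ne_top_of_le_ne_top ?_ (lintegral_cuboid_conv_le hp hq hK₁ hK₂ hfcont hψ)
    exact ENNReal.mul_ne_top ENNReal.ofReal_ne_top hfin.ne
  set G := (∫⁻ z in cuboid d K₁ K₂, ‖conv f ψ z‖ₑ).toReal with hG
  have hGeq : ∫⁻ z in cuboid d K₁ K₂, ‖conv f ψ z‖ₑ = ENNReal.ofReal G :=
    (ENNReal.ofReal_toReal hGtop).symm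
  have hG0 : 0 ≤ G := ENNReal.toReal_nonneg
  have hcG : c₁ * G ≤ (∫⁻ z, ‖conv f ψ z‖ₑ ∂law K₁ K₂ ρ).toReal := by
    rw [hGeq, ← ENNReal.ofReal_mul hc₁.le] at hlow
    exact (ENNReal.ofReal_le_iff_le_toReal hltop).1 hlow
  rcases hA0.eq_or_lt with h0 | hApos
  · rw [← h0, mul_zero]
    exact ENNReal.toReal_nonneg
  refine le_trans ?_ hcG
  have hpq : 1 < p * q := one_lt_mul_of_lt_of_le hp hq.le
  -- Trade of powers: |g|^{pq} ≤ ‖g‖_∞^{pq-1}|g| turns the lower bound in L^{p,q} into one in L¹.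
  -- Cancelling A^{pq-1}, possible since A > 0 here, makes it linear in A.
  have hkey : (ω * A) ^ (p * q) ≤
      boxFactor d p q K₁ K₂ * ((cs * A * nψ) ^ (p * q - 1) * G) := by
    have hpt : ∀ z, ‖conv f ψ z‖ₑ ^ (p * q) ≤
        ENNReal.ofReal ((cs * A * nψ) ^ (p * q - 1)) * ‖conv f ψ z‖ₑ := by
      intro z
      rw [← ofReal_norm, ENNReal.ofReal_rpow_of_nonneg (norm_nonneg _) (by positivity),
        ← ENNReal.ofReal_mul (by positivity)]
      apply ENNReal.ofReal_le_ofReal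
      rcases (norm_nonneg (conv f ψ z)).eq_or_lt with h | h
      · rw [← h, Real.zero_rpow (by positivity), mul_zero]
      · calc ‖conv f ψ z‖ ^ (p * q) = ‖conv f ψ z‖ ^ (p * q - 1) * ‖conv f ψ z‖ := by
              rw [← Real.rpow_add_one h.ne']
              congr 1
              ring
          _ ≤ _ := by
              gcongr
              exact hgb z
    have h := (ENNReal.rpow_le_rpow hfω (by positivity : 0 ≤ p * q)).trans
      (mixedNormCuboid_rpow_le hp hq hK₁ hK₂ hg)
    have h2 := h.trans (mul_le_mul' le_rfl (lintegral_mono hpt))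
    rw [lintegral_const_mul' _ _ ENNReal.ofReal_ne_top, hGeq, hAeq, ← ENNReal.ofReal_mul hω.le,
      ENNReal.ofReal_rpow_of_nonneg (by positivity) (by positivity),
      ← ENNReal.ofReal_mul (by positivity), ← ENNReal.ofReal_mul hD.le] at h2
    exact (ENNReal.ofReal_le_ofReal_iff (by positivity)).1 h2
  have hX : 0 < cs * nψ := by positivity
  have e1 : (ω * A) ^ (p * q) = ω ^ (p * q) * A ^ (p * q - 1) * A := by
    rw [Real.mul_rpow hω.le hA0, mul_assoc, ← Real.rpow_add_one hApos.ne', sub_add_cancel]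
  have e2 : (cs * A * nψ) ^ (p * q - 1) = (cs * nψ) ^ (p * q - 1) * A ^ (p * q - 1) := by
    rw [← Real.mul_rpow hX.le hA0]
    congr 1
    ring
  have e3 : (cs * nψ) ^ (1 - p * q) = ((cs * nψ) ^ (p * q - 1))⁻¹ := by
    rw [← Real.rpow_neg hX.le, neg_sub]
  rw [e1, e2] at hkey
  have hApow : 0 < A ^ (p * q - 1) := by positivity
  have hXpow : 0 < (cs * nψ) ^ (p * q - 1) := by positivity
  have hkey' : ω ^ (p * q) * A ≤ boxFactor d p q K₁ K₂ * (cs * nψ) ^ (p * q - 1) * G := by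
    refine le_of_mul_le_mul_left ?_ hApow
    calc _ = ω ^ (p * q) * A ^ (p * q - 1) * A := by ring
      _ ≤ _ := hkey
      _ = _ := by ring
  rw [level, e3]
  calc c₁ * ((cs * nψ) ^ (p * q - 1))⁻¹ * ω ^ (p * q) / boxFactor d p q K₁ K₂ * A
      = c₁ * (ω ^ (p * q) * A / (boxFactor d p q K₁ K₂ * (cs * nψ) ^ (p * q - 1))) := by
        field_simp
    _ ≤ c₁ * G := by
        gcongr
        rw [div_le_iff₀ (by positivity)]
        linarith

/-- The exponent of the sampling theorem in terms of the normalised deviation. -/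
lemma beta₁_le (hK₁ : 0 < K₁) (hK₂ : 0 < K₂) (hc₁ : 0 < c₁) {cs nψ ω γ : ℝ}
    (hcs : 0 < cs) (hnψ : 0 < nψ) (hω : 0 < ω) (hγ : 0 < γ) :
    beta₁ d p q K₁ K₂ c₁ cs nψ ω γ ≤
      (γ * level d p q K₁ K₂ c₁ cs nψ ω / (cs * nψ)) ^ 2 / 8 := by
  have hD : 0 < boxFactor d p q K₁ K₂ := boxFactor_pos hK₁ hK₂
  have hX : 0 < cs * nψ := by positivity
  set D := boxFactor d p q K₁ K₂ with hD_def
  set τ := ratio p q c₁ cs nψ ω γ with hτ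
  have hτ0 : 0 < τ := by
    rw [hτ, ratio]
    positivity
  have hinv : (2 * K₁) ^ (1 - q) * (2 * K₂) ^ ((d : ℝ) * (1 - p)) = D⁻¹ := by
    rw [hD_def, boxFactor, mul_inv, ← Real.rpow_neg (by positivity), ← Real.rpow_neg (by positivity)]
    congr 2 <;> ring
  have hlev : γ * level d p q K₁ K₂ c₁ cs nψ ω / (cs * nψ) = τ / D := by
    rw [level, hτ, ratio, Real.div_rpow hω.le hX.le, ← hD_def, Real.rpow_sub hX, Real.rpow_one]
    field_simp
  rw [beta₁, hinv, hlev, ← hτ, ← hD_def, mul_pow, div_pow, Real.sq_sqrt (by norm_num)]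
  -- Dropping τ from the denominator leaves (3/4)/6 = 1/8 times (τ/D)², and τ/D is the normalised
  -- deviation.
  calc D⁻¹ * (3 / 2 ^ 2 * τ ^ 2) / (6 * D + τ) ≤ D⁻¹ * (3 / 2 ^ 2 * τ ^ 2) / (6 * D) := by
        gcongr
        linarith
    _ = _ := by
        field_simp
        norm_num

/-- The lower bound on the number of samples in terms of the normalised deviation. -/
lemma lt_of_sampleThreshold_lt {N : ℕ} {cs nψ ω γ X : ℝ} (hr : 1 ≤ r) (hcs : 0 < cs)
    (hnψ : 0 < nψ) (hlev : 0 < γ * level d p q K₁ K₂ c₁ cs nψ ω)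
    (h : sampleThreshold d r N p q K₁ K₂ c₁ cs nψ ω γ < X) :
    4200 * (r * (2 * N + 1) ^ (d + 1) : ℝ) <
      X * (γ * level d p q K₁ K₂ c₁ cs nψ ω / (cs * nψ)) ^ 2 * cs ^ 2 := by
  unfold sampleThreshold at h
  set lam := γ * level d p q K₁ K₂ c₁ cs nψ ω
  have hr' : (0 : ℝ) < r := by exact_mod_cast hr
  set M : ℝ := r * (2 * N + 1) ^ (d + 1) with hM
  have hM0 : 0 < M := by positivity
  have h2 : (1.4 : ℝ) ≤ √2 := Real.le_sqrt_of_sq_le (by norm_num)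
  have h3 : (0.69 : ℝ) ≤ Real.log 2 := le_trans (by norm_num) Real.log_two_gt_d9.le
  have h4 : (0.966 : ℝ) ≤ √2 * Real.log 2 :=
    calc (0.966 : ℝ) = 1.4 * 0.69 := by norm_num
      _ ≤ _ := by gcongr
  have h5 : 54 * r * √2 * Real.log 2 * (2 * N + 1) ^ (d + 1) * nψ / lam ^ 2 * (2 * lam + 81 * nψ) =
      54 * M * (√2 * Real.log 2) * nψ * (2 * lam + 81 * nψ) / lam ^ 2 := by
    rw [hM]
    ring
  rw [h5, div_lt_iff₀ (by positivity)] at h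
  -- The summand 2γL is discarded; 54·81·0.966 > 4225 gives the constant 4200.
  have h6 : 54 * M * 0.966 * nψ * (81 * nψ) ≤
      54 * M * (√2 * Real.log 2) * nψ * (2 * lam + 81 * nψ) := by
    gcongr
    linarith
  have h7 : X * (lam / (cs * nψ)) ^ 2 * cs ^ 2 = X * lam ^ 2 / nψ ^ 2 := by
    field_simp
  rw [h7, lt_div_iff₀ (by positivity)]
  have h8 : 0 < M * nψ ^ 2 := by positivity
  nlinarith

end MixedSampling

/-! ### The sampling theorem -/

open MixedSampling

theorem theorem3p1
    (d r : ℕ) (hd : 1 ≤ d) (hr : 1 ≤ r) (p q : ℝ) (hp : 1 < p) (hq : 1 < q)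
    (K₁ K₂ : ℝ) (hK₁ : 0 < K₁) (hK₂ : 0 < K₂)
    (φ : Fin r → MixedSampling.Pt d → ℂ) (α₁ α₂ ct s₁ s₂ : ℝ)
    (hφ : MixedSampling.Generators p q α₁ α₂ ct s₁ s₂ φ)
    (ψ : MixedSampling.Pt d → ℂ) (hψ : MixedSampling.Averaging K₁ K₂ ψ)
    (ρ : MixedSampling.Pt d → ℝ) (c₁ c₂ : ℝ) (hρ : MixedSampling.Density K₁ K₂ c₁ c₂ ρ)
    {Ω : Type*} [MeasurableSpace Ω] (P : Measure Ω) [IsProbabilityMeasure P]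
    (Z : ℕ × ℕ → Ω → MixedSampling.Pt d) (hZ : ∀ a, Measurable (Z a))
    (hindep : iIndepFun Z P)
    (hlaw : ∀ a, P.map (Z a) = MixedSampling.law K₁ K₂ ρ)
    (cs : ℝ) (hcs : cs = MixedSampling.cStar d p q α₁ ct s₁ s₂)
    (nψ : ℝ) (hnψ : nψ = MixedSampling.avgNorm K₁ K₂ ψ)
    (N : ℕ) (hN : 1 ≤ N) (γ : ℝ) (hγ₀ : 0 < γ) (hγ₁ : γ < 1)
    (ω : ℝ) (hω₀ : 0 < ω) (hω₁ : ω ≤ nψ)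
    (n m : ℕ)
    (hnm : MixedSampling.sampleThreshold d r N p q K₁ K₂ c₁ cs nψ ω γ < (n : ℝ) * m) :
    1 - MixedSampling.probA₁ d r N cs
          * Real.exp (-((n : ℝ) * m * MixedSampling.beta₁ d p q K₁ K₂ c₁ cs nψ ω γ))
      - MixedSampling.probA₂ d r N cs
          * Real.exp (-((n : ℝ) * m * MixedSampling.beta₂ d p q K₁ K₂ c₁ cs nψ ω γ))
      ≤ P.real {w | ∀ f ∈ MixedSampling.VNomega p q K₁ K₂ N ω ψ φ,
          ENNReal.ofReal (MixedSampling.lowerConst d n m p q K₁ K₂ c₁ cs nψ ω γ)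
                * MixedSampling.mixedNorm p q f
              ≤ MixedSampling.sampleNorm p q n m
                  (fun j k => MixedSampling.conv f ψ (Z (j, k) w)) ∧
            MixedSampling.sampleNorm p q n m
                  (fun j k => MixedSampling.conv f ψ (Z (j, k) w))
              ≤ ENNReal.ofReal (MixedSampling.upperConst d n m p q K₁ K₂ c₁ c₂ cs nψ ω γ)
                * MixedSampling.mixedNorm p q f} := by
  have hp0 : 0 < p := by linarith
  have hq0 : 0 < q := by linarith
  have hcs0 : 0 < cs := hcs ▸ cStar_pos hd hp hq hφ
  have hnψ0 : 0 < nψ := hω₀.trans_le hω₁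
  have hc₁ := hρ.c_one_pos
  have hc₂ := hρ.c_two_pos
  have hD : 0 < boxFactor d p q K₁ K₂ := boxFactor_pos hK₁ hK₂
  have hr0 : (0 : ℝ) < r := by exact_mod_cast hr
  have hX : 0 < cs * nψ := by positivity
  set L := level d p q K₁ K₂ c₁ cs nψ ω with hL
  have hL0 : 0 < L := by
    rw [hL, level]
    positivity
  have hlam : 0 < γ * L := by positivity
  set t := γ * L / (cs * nψ) with ht
  have ht0 : 0 < t := by positivity
  set M : ℝ := r * (2 * N + 1) ^ (d + 1) with hM
  have hM0 : 0 < M := by positivity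
  have hthr : 4200 * M < n * m * t ^ 2 * cs ^ 2 := lt_of_sampleThreshold_lt hr hcs0 hnψ0 hlam hnm
  have hnm0 : (0 : ℝ) < n * m := by
    by_contra hcon
    have : (n : ℝ) * m * (t ^ 2 * cs ^ 2) ≤ 0 :=
      mul_nonpos_of_nonpos_of_nonneg (not_lt.1 hcon) (by positivity)
    linarith
  have hn0 : (0 : ℝ) < n := by
    rcases Nat.eq_zero_or_pos n with h | h
    · simp [h] at hnm0
    · exact_mod_cast h
  have hm0 : (0 : ℝ) < m := by
    rcases Nat.eq_zero_or_pos m with h | h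
    · simp [h] at hnm0
    · exact_mod_cast h
  have hβ : beta₁ d p q K₁ K₂ c₁ cs nψ ω γ ≤ t ^ 2 / 8 := beta₁_le hK₁ hK₂ hc₁ hcs0 hnψ0 hω₀ hγ₀
  have hA₂ : 0 ≤ probA₂ d r N cs * Real.exp (-((n : ℝ) * m * beta₂ d p q K₁ K₂ c₁ cs nψ ω γ)) := by
    unfold probA₂
    positivity
  have hexp : Real.exp (-(n * m * t ^ 2 / 8)) ≤
      Real.exp (-((n : ℝ) * m * beta₁ d p q K₁ K₂ c₁ cs nψ ω γ)) := by
    apply Real.exp_le_exp.2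
    have := mul_le_mul_of_nonneg_left hβ hnm0.le
    linarith
  have hlog : 0 ≤ Real.log (4 * cs + 1) := Real.log_nonneg (by linarith)
  have hA₁ : probA₁ d r N cs = 2 * Real.exp (M * Real.log (4 * cs + 1)) := rfl
  -- If chaining is unavailable, the probability bound is void: nmβ₁ ≤ nm t²/8 < 3M, and 𝒜₁ ≥
  -- 2e^{3M} by the next two steps.
  rcases lt_or_ge (n * m * t ^ 2) (24 * M) with hsmall | hlarge
  -- 24·13² = 4056 < 4200, so c* < 13 would contradict the threshold.
  · have hcs13 : 13 ≤ cs := by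
      by_contra hcon
      have h1 : cs ^ 2 ≤ 13 ^ 2 := by gcongr; linarith
      have h2 : n * m * t ^ 2 * cs ^ 2 ≤ 24 * M * 13 ^ 2 := by gcongr
      linarith
    have hlog3 : 3 ≤ Real.log (4 * cs + 1) := by
      rw [Real.le_log_iff_exp_le (by linarith), show (3 : ℝ) = (3 : ℕ) * 1 by norm_num,
        Real.exp_nat_mul]
      calc Real.exp 1 ^ 3 ≤ 3 ^ 3 := by
            gcongr
            exact Real.exp_one_lt_three.le
        _ ≤ _ := by linarith
    have h1 : 1 ≤ Real.exp (M * Real.log (4 * cs + 1)) *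
        Real.exp (-((n : ℝ) * m * beta₁ d p q K₁ K₂ c₁ cs nψ ω γ)) := by
      refine le_trans ?_ (mul_le_mul_of_nonneg_left hexp (Real.exp_pos _).le)
      rw [← Real.exp_add]
      apply Real.one_le_exp
      nlinarith
    have h2 : 0 ≤ P.real {w | ∀ f ∈ VNomega p q K₁ K₂ N ω ψ φ,
        ENNReal.ofReal (lowerConst d n m p q K₁ K₂ c₁ cs nψ ω γ) * mixedNorm p q f
              ≤ sampleNorm p q n m (fun j k => conv f ψ (Z (j, k) w)) ∧
            sampleNorm p q n m (fun j k => conv f ψ (Z (j, k) w))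
              ≤ ENNReal.ofReal (upperConst d n m p q K₁ K₂ c₁ c₂ cs nψ ω γ) * mixedNorm p q f} :=
      measureReal_nonneg
    rw [hA₁]
    linarith
  · set s := Finset.Icc 1 n ×ˢ Finset.Icc 1 m with hs
    have hcard : (s.card : ℝ) = n * m := by simp [hs]
    obtain ⟨B, hBm, hB, hdev⟩ := sample_deviation hd hr hp hq hφ hψ (hnψ ▸ hnψ0) P hZ hindep hlaw s
      N ht0 (by rw [hcard]; exact hlarge)
    rw [hcard, ← hcs, ← hnψ] at hdev
    rw [hcard] at hB
    have hgood : Bᶜ ⊆ {w | ∀ f ∈ VNomega p q K₁ K₂ N ω ψ φ,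
        ENNReal.ofReal (lowerConst d n m p q K₁ K₂ c₁ cs nψ ω γ) * mixedNorm p q f
              ≤ sampleNorm p q n m (fun j k => conv f ψ (Z (j, k) w)) ∧
            sampleNorm p q n m (fun j k => conv f ψ (Z (j, k) w))
              ≤ ENNReal.ofReal (upperConst d n m p q K₁ K₂ c₁ c₂ cs nψ ω γ) *
                mixedNorm p q f} := by
      intro w hw f hf
      have h := abs_le.1 (hdev w hw f hf.1)
      have hmean := mean_bounds hd hp hq hK₁ hK₂ hφ hψ (hnψ ▸ hnψ0) hρ hω₀ hf
      rw [← hcs, ← hnψ, ← hL] at hmean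
      have hfin := (VN_bound hd hp hq hφ hf.1).1
      set A := (mixedNorm p q f).toReal with hA
      have hAeq : mixedNorm p q f = ENNReal.ofReal A := (ENNReal.ofReal_toReal hfin.ne).symm
      have hA0 : 0 ≤ A := ENNReal.toReal_nonneg
      have htX : t * (cs * nψ) = γ * L := div_mul_cancel₀ _ hX.ne'
      rw [htX] at h
      set I := ∫ z, ‖conv f ψ z‖ ∂law K₁ K₂ ρ
      set T := ∑ i ∈ s, ‖conv f ψ (Z i w)‖ with hT
      have hsum : ∑ j ∈ Finset.Icc 1 n, ∑ k ∈ Finset.Icc 1 m, ‖conv f ψ (Z (j, k) w)‖ₑ =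
          ENNReal.ofReal T := by
        rw [hT, hs, Finset.sum_product,
          ENNReal.ofReal_sum_of_nonneg fun j _ => Finset.sum_nonneg fun k _ => norm_nonneg _]
        refine Finset.sum_congr rfl fun j _ => ?_
        rw [ENNReal.ofReal_sum_of_nonneg fun k _ => norm_nonneg _]
        exact Finset.sum_congr rfl fun k _ => (ofReal_norm _).symm
      rw [hAeq]
      constructor
      · have h1 := sum_le_sampleNorm hp hq n m fun j k => conv f ψ (Z (j, k) w)
        rw [hsum] at h1
        have hW : 0 < (n : ℝ) ^ ((p - 1) / p) * (m : ℝ) ^ ((q - 1) / q) := by positivity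
        -- The mean is at least LA and the deviation per sample at most γLA.
        have hTlow : (1 - γ) * L * (n * m) * A ≤ T := by
          have := mul_le_mul_of_nonneg_left hmean.1 hnm0.le
          linarith [h.1]
        refine (ENNReal.mul_le_mul_iff_right (a := ENNReal.ofReal
          ((n : ℝ) ^ ((p - 1) / p) * (m : ℝ) ^ ((q - 1) / q))) (by simpa using hW)
          ENNReal.ofReal_ne_top).1 (le_trans ?_ h1)
        rw [← ENNReal.ofReal_mul' hA0, ← ENNReal.ofReal_mul hW.le]
        apply ENNReal.ofReal_le_ofReal
        refine le_trans (le_of_eq ?_) hTlow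
        have e1 : (n : ℝ) ^ ((p - 1) / p) * (n : ℝ) ^ (1 / p) = n := by
          rw [← Real.rpow_add hn0, ← add_div, sub_add_cancel, div_self hp0.ne', Real.rpow_one]
        have e2 : (m : ℝ) ^ ((q - 1) / q) * (m : ℝ) ^ (1 / q) = m := by
          rw [← Real.rpow_add hm0, ← add_div, sub_add_cancel, div_self hq0.ne', Real.rpow_one]
        rw [lowerConst, ← hL]
        calc _ = (1 - γ) * L * (((n : ℝ) ^ ((p - 1) / p) * (n : ℝ) ^ (1 / p)) *
              ((m : ℝ) ^ ((q - 1) / q) * (m : ℝ) ^ (1 / q))) * A := by ring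
          _ = _ := by rw [e1, e2]
      · refine (sampleNorm_le_sum hp hq n m _).trans ?_
        rw [hsum, ← ENNReal.ofReal_mul' hA0]
        apply ENNReal.ofReal_le_ofReal
        have e1 : ((2 * K₁) ^ ((1 - p) / p))⁻¹ = (2 * K₁) ^ ((p - 1) / p) := by
          rw [← Real.rpow_neg (by positivity)]
          congr 1
          ring
        have e2 : ((2 * K₂) ^ ((d : ℝ) * ((1 - q) / q)))⁻¹ =
            (2 * K₂) ^ ((d : ℝ) * ((q - 1) / q)) := by
          rw [← Real.rpow_neg (by positivity)]
          congr 1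
          ring
        rw [upperConst, ← hL, div_eq_mul_inv, mul_inv, e1, e2]
        have := mul_le_mul_of_nonneg_left hmean.2 hnm0.le
        linarith [h.2]
    have hBreal : P.real B ≤ 2 * Real.exp (-(n * m * t ^ 2 / 8)) :=
      ENNReal.toReal_le_of_le_ofReal (by positivity) hB
    have hcompl : 1 - P.real B ≤ P.real {w | ∀ f ∈ VNomega p q K₁ K₂ N ω ψ φ,
        ENNReal.ofReal (lowerConst d n m p q K₁ K₂ c₁ cs nψ ω γ) * mixedNorm p q f
              ≤ sampleNorm p q n m (fun j k => conv f ψ (Z (j, k) w)) ∧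
            sampleNorm p q n m (fun j k => conv f ψ (Z (j, k) w))
              ≤ ENNReal.ofReal (upperConst d n m p q K₁ K₂ c₁ c₂ cs nψ ω γ) *
                mixedNorm p q f} := by
      -- Only the exceptional set B has to be measurable; monotonicity handles the good event, an
      -- intersection over an uncountable class.
      rw [← probReal_compl_eq_one_sub hBm]
      exact measureReal_mono hgood
    have hfinal : 2 * Real.exp (-(n * m * t ^ 2 / 8)) ≤ probA₁ d r N cs *
        Real.exp (-((n : ℝ) * m * beta₁ d p q K₁ K₂ c₁ cs nψ ω γ)) := by
      have h1 : 1 ≤ Real.exp (M * Real.log (4 * cs + 1)) := Real.one_le_exp (by positivity)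
      rw [hA₁]
      exact mul_le_mul (by linarith) hexp (Real.exp_pos _).le (by positivity)
    linarith
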